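/- **Corollary (anticoncentration from quenched dynamics).** Let $m\ge 1$ and let $V$ be the set of the $n=m(2m+1)$ sites of the square lattice with $m$ rows and $2m+1$ columns; $[i,j]$ is the site in row $i$ and column $j$ ($1\le i\le m$, $1\le j\le 2m+1$), and a qubit is placed on every site. Put $N=2^n$. Call $[i,j]$ *pink* if $i$ is even and $j\in\{1,2m+1\}$; call a non-pink site *yellow* if $i+j$ is even and *blue* if $i+j$ is odd. *Initial states.* A configuration $\beta$ consists of a bit $b_v\in\{0,1\}$ for every pink site $v$ and a number $k_v\in\{0,1,2,3\}$ for every yellow site $v$. Let $|\psi_\beta\rangle$ be the product state whose qubit at $v$ is $|b_v\rangle$ if $v$ is pink, $e^{-\mathrm i k_v\pi Z/8}|+\rangle$ if $v$ is yellow, and $|+\rangle$ if $v$ is blue, where $|+\rangle=(|0\rangle+|1\rangle)/\sqrt2$. Let $\mathcal S_{\rm ac}=\{|\psi_\beta\rangle\}_\beta$. *Dynamics.* For nearest neighbours $u=[i,j]$, $v=[k,l]$ with $i\le k$, $j\le l$, let $\delta_{u,v}=0$ if $i\ne k$, $j\equiv 0 \pmod 4$ and $u$ is blue, or if $i\neq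 k$, $j\equiv 2\pmod 4$ and $u$ is yellow; otherwise let $\delta_{u,v}=1$. Let $\mathcal I$ be the graph on $V$ whose edges are the nearest-neighbour pairs with $\delta_{u,v}=1$, and let $$H_{\rm ac}=\sum_{\substack{u=[i,j],\,v=[k,l]\text{ nearest neighbours}\\ i\le k,\ j\le l}}\frac{\pi}{4}\,\delta_{u,v}\,Z_uZ_v-\sum_{v\in V}\frac{\pi}{4}\deg_{\mathcal I}(v)\,Z_v .$$ *Output distribution.* With $H$ the one-qubit Hadamard gate, let, for $x\in\{0,1\}^V$ and every configuration $\beta$, $$q_{\rm ac}(x,\beta)=\frac{\bigl|\langle x|H^{\otimes n}e^{-\mathrm iH_{\rm ac}}|\psi_\beta\rangle\bigr|^2}{|\mathcal S_{\rm ac}|},\qquad q_{\rm ac}(\beta)=\sum_{x}q_{\rm ac}(x,\beta),\qquad q_{\rm ac}(x|\beta)=\frac{q_{\rm ac}(x,\beta)}{q_{\rm ac}(\beta)} .$$ Then $q_{\rm ac}(\beta)=1/|\mathcal S_{\rm ac}|$ for every $\beta$, and for every $x\in\{0,1\}^V$ $$\Pr_{\beta\sim q_{\rm ac}}\Bigl(q_{\rm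 ac}(x|\beta)\ge\frac1{2N}\Bigr)\ge\frac1{12}.$$ -/

import Mathlib

open scoped Matrix

noncomputable section

namespace QuenchArch

/-! ### Systems of qubits -/

/-- Computational basis labels (bit strings) of a system of qubits located at the points of `V`. -/
abbrev Bits (V : Type) : Type := V → Fin 2

/-- Operators on the qubits at the points of `V`, as matrices in the computational basis. -/
abbrev Op (V : Type) : Type := Matrix (Bits V) (Bits V) ℂ

/-- State vectors of the qubits at the points of `V`. -/
abbrev State (V : Type) : Type := Bits V → ℂ

/-- The tensor product of one-qubit operators. -/
def tensorOp {V : Type} [Fintype V] (A : V → Matrix (Fin 2) (Fin 2) ℂ) : Op V :=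
  Matrix.of fun x z => ∏ v, A v (x v) (z v)

/-- The tensor product of one-qubit state vectors. -/
def tensorState {V : Type} [Fintype V] (φ : V → Fin 2 → ℂ) : State V :=
  fun z => ∏ v, φ v (z v)

/-- The Pauli matrix `Z`. -/
def pauliZ : Matrix (Fin 2) (Fin 2) ℂ := !![1, 0; 0, -1]

/-- The one-qubit Hadamard gate. -/
def hadamard : Matrix (Fin 2) (Fin 2) ℂ := ((1 / Real.sqrt 2 : ℝ) : ℂ) • !![1, 1; 1, -1]

/-- The computational basis state `|b⟩` of one qubit. -/
def ket (b : Fin 2) : Fin 2 → ℂ := Pi.single b 1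

/-- The state `|+⟩ = (|0⟩ + |1⟩) / √2`. -/
def ketPlus : Fin 2 → ℂ := ((1 / Real.sqrt 2 : ℝ) : ℂ) • (ket 0 + ket 1)

/-- The operator `Z_v`: Pauli `Z` on the qubit `v`, identity on all others. -/
def Zat {V : Type} [Fintype V] [DecidableEq V] (v : V) : Op V :=
  tensorOp (Function.update (fun _ => 1) v pauliZ)

/-! ### The lattice -/

/-- The sites of the lattice with `m` rows and `2m+1` columns. -/
abbrev Site (m : ℕ) : Type := Fin m × Fin (2 * m + 1)

/-- The row number, counted from 1. -/
def row {m : ℕ} (v : Site m) : ℕ := v.1.val + 1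

/-- The column number, counted from 1. -/
def col {m : ℕ} (v : Site m) : ℕ := v.2.val + 1

/-- The nearest-neighbour graph of the `m × (2m+1)` square lattice. -/
def lattice (m : ℕ) : SimpleGraph (Site m) :=
  SimpleGraph.boxProd (SimpleGraph.pathGraph m) (SimpleGraph.pathGraph (2 * m + 1))

/-- Pink sites: the left and right ends of the even rows. -/
def IsPink {m : ℕ} (v : Site m) : Prop :=
  Even (row v) ∧ (col v = 1 ∨ col v = 2 * m + 1)

/-- Yellow sites: the colour class, in the chequerboard colouring, of the top-left and the
top-right corner, without the pink sites. -/
def IsYellow {m : ℕ} (v : Site m) : Prop := ¬ IsPink v ∧ Even (row v + col v)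

/-- Blue sites: the other colour class, without the pink sites. -/
def IsBlue {m : ℕ} (v : Site m) : Prop := ¬ IsPink v ∧ Odd (row v + col v)

instance {m : ℕ} (v : Site m) : Decidable (IsPink v) := by unfold IsPink; infer_instance
instance {m : ℕ} (v : Site m) : Decidable (IsYellow v) := by unfold IsYellow; infer_instance
instance {m : ℕ} (v : Site m) : Decidable (IsBlue v) := by unfold IsBlue; infer_instance

/-- The coefficient `δ` of an edge from `u = [i,j]` to `v = [k,l]` with `i ≤ k` and `j ≤ l`. -/
def delta {m : ℕ} (u v : Site m) : ℝ :=
  if row u ≠ row v ∧ col u % 4 = 0 ∧ IsBlue u then 0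
  else if row u ≠ row v ∧ col u % 4 = 2 ∧ IsYellow u then 0
  else 1

/-- The lattice edges, each one taken once and directed from `[i,j]` to `[k,l]` with `i ≤ k` and
`j ≤ l` (the order of `Fin m × Fin (2m+1)` is componentwise). -/
def IsDirectedEdge {m : ℕ} (u v : Site m) : Prop := u ≤ v ∧ (lattice m).Adj u v

/-- The interaction sub-lattice: the lattice edges with `δ = 1`. -/
def interaction (m : ℕ) : SimpleGraph (Site m) :=
  SimpleGraph.fromRel fun u v => IsDirectedEdge u v ∧ delta u v = 1

open scoped Classical in
/-- The Ising Hamiltonian `H_ac`. -/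
def hamiltonian (m : ℕ) : Op (Site m) :=
  (∑ u : Site m, ∑ v : Site m, if IsDirectedEdge u v then
      (((Real.pi / 4 * delta u v : ℝ)) : ℂ) • (Zat u * Zat v) else 0)
    - ∑ v : Site m, ((Real.pi / 4 * ((interaction m).degree v : ℝ) : ℝ) : ℂ) • Zat v

/-! ### Initial states -/

/-- The random choices `β`: a bit for every pink site, a number `k ∈ {0,1,2,3}` for every yellow
site. -/
abbrev Config (m : ℕ) : Type :=
  ({v : Site m // IsPink v} → Fin 2) × ({v : Site m // IsYellow v} → Fin 4)

/-- The initial state of the qubit at `v`: `|b⟩` at pink sites, `exp(-i k π Z / 8) |+⟩` at yellow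
sites, `|+⟩` at blue sites. -/
def siteState {m : ℕ} (β : Config m) (v : Site m) : Fin 2 → ℂ :=
  if h : IsPink v then ket (β.1 ⟨v, h⟩)
  else if h : IsYellow v then
    NormedSpace.exp ((-(Complex.I * (((β.2 ⟨v, h⟩).val : ℝ) * Real.pi / 8 : ℝ))) • pauliZ) *ᵥ ketPlus
  else ketPlus

/-- The product state `|ψ_β⟩`. -/
def psi {m : ℕ} (β : Config m) : State (Site m) := tensorState (siteState β)

/-- The finite family `S_ac` of initial states. -/
def Sac (m : ℕ) : Set (State (Site m)) := Set.range (psi (m := m))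

/-! ### The output distribution -/

/-- The amplitude `⟨x| H^{⊗n} exp(-i H_ac) |ψ_β⟩`. -/
def amplitude {m : ℕ} (x : Bits (Site m)) (β : Config m) : ℂ :=
  ((tensorOp (fun _ : Site m => hadamard) * NormedSpace.exp ((-Complex.I) • hamiltonian m))
    *ᵥ psi β) x

/-- The joint distribution `q_ac(x, β)`. -/
def qJoint {m : ℕ} (x : Bits (Site m)) (β : Config m) : ℝ :=
  ‖amplitude x β‖ ^ 2 / ((Sac m).ncard : ℝ)

/-- The marginal `q_ac(β)`. -/
def qMarginal {m : ℕ} (β : Config m) : ℝ := ∑ x : Bits (Site m), qJoint x β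

/-- The conditional distribution `q_ac(x | β)`. -/
def qCond {m : ℕ} (x : Bits (Site m)) (β : Config m) : ℝ := qJoint x β / qMarginal β

open scoped Classical in
/-- The probability of an event when `β` is drawn from `q_ac(β)`. -/
def prConfig {m : ℕ} (P : Config m → Prop) : ℝ := ∑ β : Config m, if P β then qMarginal β else 0

/-- The dimension `N = 2^n` of the system of `n = m(2m+1)` qubits. -/
def dimN (m : ℕ) : ℕ := 2 ^ (m * (2 * m + 1))

end QuenchArch

end

set_option linter.unusedSectionVars false

open scoped Matrix ComplexConjugate

namespace QuenchArch

/-! ### Signs and phases -/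

/-! Up to a global phase, the evolution is a controlled-Z gate on every bond. In the expansion of
the amplitude over the computational basis, the pink bits are fixed by β, and summing over a blue
bit forces the sum of the neighbouring yellow bits to equal the outcome there. What remains is a
constant times a sum S(β) of M unimodular terms, one for each path, that is, each yellow bit
assignment in a coset C of the kernel of the blue checks (`exists_amplitude_eq`). The blue checks
are independent (`checkHom_isBlue_surjective`), so M = 2^(|Y| - |B|) with |Y|, |B| the numbers of
yellow and blue sites, and the claim becomes: |S|² ≥ M/2 for at least a twelfth of all β
(`le_qCond_iff`). This is a Paley–Zygmund estimate, with E|S|² close to M and E|S|⁴ not much above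
2M².

In the fourth moment, averaging over the pink bits kills every quadruple of paths whose sum violates
a pink check. The surviving sums are 0 and, for odd m, one exceptional vector d
(`eq_zero_or_eq_oddRows`). If the sum is 0, averaging over the yellow phases kills the term as soon
as z₁ = z₂ ≠ z₃ = z₄ at some site. Only the two pairings survive, because a kernel element that
vanishes wherever another one does is zero or equal to it (`eq_zero_or_eq_of_vanish`).

Both facts rest on a description of the kernel (`exists_isOrbit`). Read column by column, the blue
checks run an odd-even transposition network: a kernel element is given by a value f(a) for each of
m particles, labelled by the odd residues a mod 2m. Odd rows show single particles, even rows sums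
of two that meet. Each particle is seen alone somewhere and any two meet, so if g vanishes wherever
f does, then f(a) = 0 gives g(a) = 0 and f(a) = f(b) gives g(a) = g(b); hence g is 0 or f. The pink
checks make f invariant under a ↦ 2 - a and a ↦ -a, hence constant, and zero if m is even.

For odd m ≥ 3 the vector d has weight at least 2(m+1), and each site of its support damps the
correlation by √(9/20). The error δ = (9/20)^(m+1) is small even against M ≤ 2^m. For m = 1 there
are just two paths, which are treated by hand. -/

/-- The sign `(-1)^a`. -/
def sgn (a : ZMod 2) : ℂ := if a = 0 then 1 else -1

@[simp] lemma sgn_zero : sgn 0 = 1 := by simp [sgn]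

@[simp] lemma sgn_one : sgn 1 = -1 := by simp [sgn]

lemma zmod_two_cases (a : ZMod 2) : a = 0 ∨ a = 1 := by
  revert a; decide

lemma sgn_add (a b : ZMod 2) : sgn (a + b) = sgn a * sgn b := by
  have h : (1 + 1 : ZMod 2) = 0 := by decide
  rcases zmod_two_cases a with rfl | rfl <;> rcases zmod_two_cases b with rfl | rfl <;>
    simp [h]

lemma sgn_sum {ι : Type*} (s : Finset ι) (f : ι → ZMod 2) :
    sgn (∑ i ∈ s, f i) = ∏ i ∈ s, sgn (f i) := by
  classical
  induction s using Finset.induction_on with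
  | empty => simp
  | insert i s hi ih => rw [Finset.sum_insert hi, Finset.prod_insert hi, sgn_add, ih]

@[simp] lemma norm_sgn (a : ZMod 2) : ‖sgn a‖ = 1 := by
  rcases zmod_two_cases a with rfl | rfl <;> simp

@[simp] lemma conj_sgn (a : ZMod 2) : conj (sgn a) = sgn a := by
  rcases zmod_two_cases a with rfl | rfl <;> simp

lemma sum_sgn_mul (n : ZMod 2) : ∑ b : ZMod 2, sgn (b * n) = if n = 0 then 2 else 0 := by
  have h : ∀ f : ZMod 2 → ℂ, ∑ b, f b = f 0 + f 1 := fun f => Fin.sum_univ_two f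
  rcases zmod_two_cases n with rfl | rfl <;> simp [h]
  norm_num

/-- The phase `exp(-i π (-1)^a / 8)`. -/
noncomputable def eighth (a : ZMod 2) : ℂ := Complex.exp (((-(Real.pi / 8) * if a = 0 then 1 else -1 : ℝ)) * Complex.I)

/-- The diagonal entries of `exp(-i k π Z / 8)`. -/
noncomputable def theta (k : Fin 4) (a : ZMod 2) : ℂ := eighth a ^ k.val

@[simp] lemma norm_eighth (a : ZMod 2) : ‖eighth a‖ = 1 := Complex.norm_exp_ofReal_mul_I _

@[simp] lemma norm_theta (k : Fin 4) (a : ZMod 2) : ‖theta k a‖ = 1 := by simp [theta]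

lemma theta_eq_exp (k : Fin 4) (a : ZMod 2) :
    theta k a = Complex.exp (-(Complex.I * ((k.val : ℝ) * Real.pi / 8 : ℝ)) * sgn a) := by
  rw [theta, eighth, ← Complex.exp_nat_mul]
  congr 1
  rcases zmod_two_cases a with rfl | rfl <;> push_cast <;> simp <;> ring

/-- The average of phases seen by a yellow qubit in the fourth moment. -/
noncomputable def localCorr (a b c d : ZMod 2) : ℂ :=
  ∑ k : Fin 4, theta k a * theta k b * conj (theta k c) * conj (theta k d)

lemma norm_localCorr_le (a b c d : ZMod 2) : ‖localCorr a b c d‖ ≤ 4 := by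
  refine (norm_sum_le _ _).trans ?_
  simp

/-- The four phases are 1, u, u², u³ for one unimodular u, and 1 + u + u² + u³ = (1 + u)(1 + u²). -/
lemma localCorr_eq (a b c d : ZMod 2) : localCorr a b c d =
    (1 + eighth a * eighth b * conj (eighth c) * conj (eighth d)) *
      (1 + (eighth a * eighth b * conj (eighth c) * conj (eighth d)) ^ 2) := by
  simp only [localCorr, Fin.sum_univ_four, theta, map_pow]
  simp
  ring

lemma conj_eighth (a : ZMod 2) : conj (eighth a) = eighth (a + 1) := by
  have h : (1 + 1 : ZMod 2) = 0 := by decide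
  unfold eighth
  rw [← Complex.exp_conj]
  congr 1
  rcases zmod_two_cases a with rfl | rfl <;> simp [h, Complex.conj_ofNat]

lemma eighth_mul (a b : ZMod 2) : eighth a * eighth b =
    if a = b then Complex.exp (((-(Real.pi / 4) * if a = 0 then 1 else -1 : ℝ)) * Complex.I)
    else 1 := by
  unfold eighth
  rw [← Complex.exp_add]
  rcases zmod_two_cases a with rfl | rfl <;> rcases zmod_two_cases b with rfl | rfl <;>
    simp <;> congr 1 <;> ring

/-- Here u is a product of four equal eighths, so u = ±i and the factor 1 + u² vanishes. -/
lemma localCorr_eq_zero (a c : ZMod 2) (h : a ≠ c) : localCorr a a c c = 0 := by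
  have e : ∀ x : ℝ, x = Real.pi / 4 ∨ x = -(Real.pi / 4) →
      1 + (Complex.exp (x * Complex.I) * Complex.exp (x * Complex.I)) ^ 2 = 0 := by
    rintro x (rfl | rfl)
    · rw [← Complex.exp_add, ← Complex.exp_nat_mul,
        show ((2 : ℕ) : ℂ) * ((Real.pi / 4 : ℝ) * Complex.I + (Real.pi / 4 : ℝ) * Complex.I)
          = Real.pi * Complex.I by push_cast; ring, Complex.exp_pi_mul_I]
      ring
    · rw [← Complex.exp_add, ← Complex.exp_nat_mul,
        show ((2 : ℕ) : ℂ) * ((-(Real.pi / 4) : ℝ) * Complex.I + (-(Real.pi / 4) : ℝ) * Complex.I)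
          = -(Real.pi * Complex.I) by push_cast; ring, Complex.exp_neg, Complex.exp_pi_mul_I]
      norm_num
  have hc : c + 1 = a := by revert a c; decide
  rw [localCorr_eq, conj_eighth, hc, mul_assoc, eighth_mul, if_pos rfl, e, mul_zero]
  rcases zmod_two_cases a with rfl | rfl <;> simp

/-- With odd parity three of the four eighths agree and one is opposite, so u = exp(±iπ/4) and |1 +
u|²|1 + u²|² = 2(2 + √2). The rational 9/20 lies slightly above 2(2 + √2)/16 and below 1/2, so that
it still wins against 2^m paths. -/
lemma norm_localCorr_odd (a b c d : ZMod 2) (h : a + b + c + d ≠ 0) :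
    ‖localCorr a b c d‖ ≤ 4 * √(9 / 20) := by
  obtain ⟨x, hx, hu⟩ : ∃ x : ℝ, (x = Real.pi / 4 ∨ x = -(Real.pi / 4)) ∧
      eighth a * eighth b * conj (eighth c) * conj (eighth d) = Complex.exp (x * Complex.I) := by
    have h2 : (1 + 1 : ZMod 2) = 0 := by decide
    simp only [conj_eighth]
    rw [mul_assoc, eighth_mul, eighth_mul]
    rcases zmod_two_cases a with rfl | rfl <;> rcases zmod_two_cases b with rfl | rfl <;>
    rcases zmod_two_cases c with rfl | rfl <;> rcases zmod_two_cases d with rfl | rfl <;>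
      simp [h2] at h ⊢
  rw [localCorr_eq, hu]
  have hs : (√2 : ℝ) ^ 2 = 2 := Real.sq_sqrt (by norm_num)
  have hs1 : (√2 : ℝ) ≤ 1.5 := by rw [Real.sqrt_le_left (by norm_num)]; norm_num
  have hz : Complex.exp (x * Complex.I) = ⟨√2 / 2, Real.sin x⟩ := by
    rw [Complex.exp_mul_I, ← Complex.ofReal_cos, ← Complex.ofReal_sin]
    apply Complex.ext <;> rcases hx with rfl | rfl <;> simp
  have hsin : Real.sin x ^ 2 = 1 / 2 := by
    rcases hx with rfl | rfl <;> simp [div_pow, hs] <;> norm_num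
  apply abs_le_of_sq_le_sq' _ (by positivity) |>.2
  rw [mul_pow, Real.sq_sqrt (by norm_num), norm_mul, mul_pow, ← Complex.normSq_eq_norm_sq,
    ← Complex.normSq_eq_norm_sq, hz]
  simp only [Complex.normSq_apply, pow_two, Complex.add_re, Complex.add_im, Complex.mul_re,
    Complex.mul_im, Complex.one_re, Complex.one_im]
  have e1 : (1 + √2 / 2) * (1 + √2 / 2) + (0 + Real.sin x) * (0 + Real.sin x) = 2 + √2 := by
    nlinarith
  have e2 : (√2 / 2 * (√2 / 2) - Real.sin x * Real.sin x) = 0 := by nlinarith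
  have e3 : (0 + (√2 / 2 * Real.sin x + Real.sin x * (√2 / 2))) *
      (0 + (√2 / 2 * Real.sin x + Real.sin x * (√2 / 2))) = √2 ^ 2 * Real.sin x ^ 2 := by ring
  rw [e1, e2, e3, hs, hsin]
  linarith

/-! ### Moments of random path sums -/

section Moments

variable {Y P : Type} [Fintype Y] [DecidableEq Y] [Fintype P] [DecidableEq P]

/-- The contribution of one path `z` to a path sum with random signs `β.1` and random phases
`β.2`. -/
noncomputable def pathTerm (xY : Y → ZMod 2) (c : P → ZMod 2) (N : (Y → ZMod 2) →+ (P → ZMod 2))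
    (β : (P → ZMod 2) × (Y → Fin 4)) (z : Y → ZMod 2) : ℂ :=
  (∏ p, sgn (β.1 p * (c p + N z p))) * ∏ y, (sgn (xY y * z y) * theta (β.2 y) (z y))

lemma norm_pathTerm (xY : Y → ZMod 2) (c : P → ZMod 2) (N : (Y → ZMod 2) →+ (P → ZMod 2))
    (β : (P → ZMod 2) × (Y → Fin 4)) (z : Y → ZMod 2) : ‖pathTerm xY c N β z‖ = 1 := by
  simp [pathTerm, norm_prod]

/-- The fourth-order correlation of path contributions. -/
noncomputable def pathCorr (xY : Y → ZMod 2) (c : P → ZMod 2) (N : (Y → ZMod 2) →+ (P → ZMod 2))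
    (z₁ z₂ z₃ z₄ : Y → ZMod 2) : ℂ :=
  ∑ β, pathTerm xY c N β z₁ * pathTerm xY c N β z₂ * conj (pathTerm xY c N β z₃) *
    conj (pathTerm xY c N β z₄)

lemma sgn_mul_four (b c n₁ n₂ n₃ n₄ : ZMod 2) :
    sgn (b * (c + n₁)) * sgn (b * (c + n₂)) * sgn (b * (c + n₃)) * sgn (b * (c + n₄)) =
      sgn (b * (n₁ + n₂ + n₃ + n₄)) := by
  simp only [← sgn_add]
  congr 1
  have h : (2 : ZMod 2) = 0 := by decide
  linear_combination (2 * b * c) * h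

lemma sum_prod_pi {ι κ : Type*} [Fintype ι] [DecidableEq ι] [Fintype κ] (f : ι → κ → ℂ) :
    ∑ g : ι → κ, ∏ i, f i (g i) = ∏ i, ∑ k, f i k := by
  rw [Finset.prod_univ_sum, Fintype.piFinset_univ]

/-- The random choices at different sites are independent, so the sum over β factorises. The offset
`c` occurs four times and cancels modulo 2. -/
lemma pathCorr_eq (xY : Y → ZMod 2) (c : P → ZMod 2) (N : (Y → ZMod 2) →+ (P → ZMod 2))
    (z₁ z₂ z₃ z₄ : Y → ZMod 2) :
    pathCorr xY c N z₁ z₂ z₃ z₄ =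
      (∏ p, ∑ b, sgn (b * N (z₁ + z₂ + z₃ + z₄) p)) *
        ∏ y, (sgn (xY y * (z₁ + z₂ + z₃ + z₄) y) * localCorr (z₁ y) (z₂ y) (z₃ y) (z₄ y)) := by
  simp only [localCorr, Finset.mul_sum]
  rw [← sum_prod_pi, ← sum_prod_pi, Fintype.sum_mul_sum, ← Fintype.sum_prod_type', pathCorr]
  refine Finset.sum_congr rfl fun β _ => ?_
  simp only [pathTerm, map_mul, map_prod, conj_sgn]
  have h1 : ∏ p, sgn (β.1 p * N (z₁ + z₂ + z₃ + z₄) p) =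
      (∏ p, sgn (β.1 p * (c p + N z₁ p))) * (∏ p, sgn (β.1 p * (c p + N z₂ p))) *
      (∏ p, sgn (β.1 p * (c p + N z₃ p))) * (∏ p, sgn (β.1 p * (c p + N z₄ p))) := by
    simp only [← Finset.prod_mul_distrib]
    refine Finset.prod_congr rfl fun p _ => ?_
    rw [sgn_mul_four]; simp
  have h2 : ∏ y, (sgn (xY y * (z₁ + z₂ + z₃ + z₄) y) * (theta (β.2 y) (z₁ y) *
      theta (β.2 y) (z₂ y) * conj (theta (β.2 y) (z₃ y)) * conj (theta (β.2 y) (z₄ y)))) =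
      (∏ y, (sgn (xY y * z₁ y) * theta (β.2 y) (z₁ y))) *
      (∏ y, (sgn (xY y * z₂ y) * theta (β.2 y) (z₂ y))) *
      (∏ y, (sgn (xY y * z₃ y) * conj (theta (β.2 y) (z₃ y)))) *
      (∏ y, (sgn (xY y * z₄ y) * conj (theta (β.2 y) (z₄ y)))) := by
    simp only [← Finset.prod_mul_distrib]
    refine Finset.prod_congr rfl fun y _ => ?_
    simp only [Pi.add_apply, mul_add, sgn_add]
    ring
  rw [h1, h2]
  ring

lemma pathCorr_eq_zero_of_sign (xY : Y → ZMod 2) (c : P → ZMod 2)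
    (N : (Y → ZMod 2) →+ (P → ZMod 2)) (z₁ z₂ z₃ z₄ : Y → ZMod 2)
    (h : N (z₁ + z₂ + z₃ + z₄) ≠ 0) : pathCorr xY c N z₁ z₂ z₃ z₄ = 0 := by
  obtain ⟨p, hp⟩ := Function.ne_iff.1 h
  rw [pathCorr_eq, Finset.prod_eq_zero (Finset.mem_univ p), zero_mul]
  rw [sum_sgn_mul]
  exact if_neg hp

lemma pathCorr_eq_zero_of_phase (xY : Y → ZMod 2) (c : P → ZMod 2)
    (N : (Y → ZMod 2) →+ (P → ZMod 2)) (z₁ z₂ z₃ z₄ : Y → ZMod 2) (y : Y)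
    (h12 : z₁ y = z₂ y) (h34 : z₃ y = z₄ y) (h13 : z₁ y ≠ z₃ y) :
    pathCorr xY c N z₁ z₂ z₃ z₄ = 0 := by
  rw [pathCorr_eq, Finset.prod_eq_zero (Finset.mem_univ y) (i := y), mul_zero]
  rw [← h12, ← h34, localCorr_eq_zero _ _ h13, mul_zero]

lemma norm_pathCorr_le (xY : Y → ZMod 2) (c : P → ZMod 2)
    (N : (Y → ZMod 2) →+ (P → ZMod 2)) (z₁ z₂ z₃ z₄ : Y → ZMod 2) :
    ‖pathCorr xY c N z₁ z₂ z₃ z₄‖ ≤ (Fintype.card ((P → ZMod 2) × (Y → Fin 4)) : ℝ) *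
      √(9 / 20) ^ (Finset.univ.filter fun y => (z₁ + z₂ + z₃ + z₄) y ≠ 0).card := by
  rw [pathCorr_eq, norm_mul, norm_prod, norm_prod, Fintype.card_prod, Nat.cast_mul, mul_assoc]
  have h1 : ∏ p, ‖∑ b, sgn (b * N (z₁ + z₂ + z₃ + z₄) p)‖ ≤ (Fintype.card (P → ZMod 2) : ℝ) := by
    rw [Fintype.card_fun, Nat.cast_pow, ZMod.card, ← Finset.card_univ, ← Finset.prod_const]
    refine Finset.prod_le_prod (fun _ _ => norm_nonneg _) fun p _ => ?_
    rw [sum_sgn_mul]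
    split_ifs <;> simp
  have h2 : ∏ y, ‖sgn (xY y * (z₁ + z₂ + z₃ + z₄) y) *
        localCorr (z₁ y) (z₂ y) (z₃ y) (z₄ y)‖ ≤ (Fintype.card (Y → Fin 4) : ℝ) *
      √(9 / 20) ^ (Finset.univ.filter fun y => (z₁ + z₂ + z₃ + z₄) y ≠ 0).card := by
    rw [Fintype.card_fun, Nat.cast_pow, Fintype.card_fin, ← Finset.card_univ, ← Finset.prod_const,
      ← Finset.prod_const, Finset.prod_filter, ← Finset.prod_mul_distrib]
    refine Finset.prod_le_prod (fun _ _ => norm_nonneg _) fun y _ => ?_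
    rw [norm_mul, norm_sgn, one_mul]
    split_ifs with h
    · exact_mod_cast norm_localCorr_odd _ _ _ _ h
    · simpa using norm_localCorr_le _ _ _ _
  exact mul_le_mul h1 h2 (Finset.prod_nonneg fun _ _ => norm_nonneg _) (Nat.cast_nonneg _)

end Moments

/-- A Paley–Zygmund inequality for finite sums. -/
lemma paley_zygmund_count {Ω : Type*} [Fintype Ω] (X : Ω → ℝ) (M δ : ℝ)
    (hM : 0 < M) (hδ : δ ≤ 1 / 2) (hδ' : (2 + M * δ) / 12 ≤ (1 / 2 - δ) ^ 2) (hδ0 : 0 ≤ δ)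
    (h1 : (Fintype.card Ω : ℝ) * M * (1 - δ) ≤ ∑ ω, X ω)
    (h2 : ∑ ω, X ω ^ 2 ≤ (Fintype.card Ω : ℝ) * M ^ 2 * (2 + M * δ)) :
    (Fintype.card Ω : ℝ) / 12 ≤ ((Finset.univ.filter fun ω => M / 2 ≤ X ω).card : ℝ) := by
  classical
  rcases Nat.eq_zero_or_pos (Fintype.card Ω) with h0 | h0
  · rw [h0]; simp
  have hc : (0 : ℝ) < Fintype.card Ω := by exact_mod_cast h0
  set C : ℝ := (Fintype.card Ω : ℝ) with hCdef
  set G := Finset.univ.filter fun ω => M / 2 ≤ X ω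
  have hsplit : ∑ ω, X ω ≤ C * (M / 2) + ∑ ω ∈ G, X ω := by
    rw [← Finset.sum_filter_add_sum_filter_not Finset.univ (fun ω => M / 2 ≤ X ω), add_comm]
    gcongr
    calc _ ≤ ∑ ω ∈ Finset.univ.filter (fun ω => ¬ M / 2 ≤ X ω), M / 2 :=
          Finset.sum_le_sum fun ω hω => (not_le.1 (Finset.mem_filter.1 hω).2).le
      _ ≤ ∑ ω : Ω, M / 2 :=
          Finset.sum_le_sum_of_subset_of_nonneg (Finset.filter_subset _ _)
            fun _ _ _ => by positivity
      _ = C * (M / 2) := by simp [C]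
  have hlow : C * M * (1 / 2 - δ) ≤ ∑ ω ∈ G, X ω := by nlinarith
  -- Cauchy–Schwarz on the good set turns a large first moment there into a large cardinality.
  have hcs : (∑ ω ∈ G, X ω) ^ 2 ≤ (G.card : ℝ) * ∑ ω, X ω ^ 2 := by
    refine sq_sum_le_card_mul_sum_sq.trans ?_
    gcongr
    exact Finset.filter_subset _ _
  have hsq : (C * M * (1 / 2 - δ)) ^ 2 ≤ (∑ ω ∈ G, X ω) ^ 2 :=
    pow_le_pow_left₀ (mul_nonneg (by positivity) (by linarith)) hlow 2
  have hpos : (0 : ℝ) < C * M ^ 2 * (2 + M * δ) := by positivity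
  have h3 : (C * M ^ 2 * (2 + M * δ)) * (C / 12) ≤ (C * M ^ 2 * (2 + M * δ)) * G.card := by
    calc (C * M ^ 2 * (2 + M * δ)) * (C / 12) = (C * M) ^ 2 * ((2 + M * δ) / 12) := by ring
      _ ≤ (C * M) ^ 2 * (1 / 2 - δ) ^ 2 := by gcongr
      _ = (C * M * (1 / 2 - δ)) ^ 2 := by ring
      _ ≤ (G.card : ℝ) * ∑ ω, X ω ^ 2 := hsq.trans hcs
      _ ≤ (G.card : ℝ) * (C * M ^ 2 * (2 + M * δ)) := by gcongr
      _ = _ := by ring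
  exact le_of_mul_le_mul_left h3 hpos

section Count

variable {Y P : Type} [Fintype Y] [DecidableEq Y] [Fintype P] [DecidableEq P]

lemma pi_add_self {ι : Type*} (z : ι → ZMod 2) : z + z = 0 := by
  funext y; exact CharTwo.add_self_eq_zero _

/-- Anticoncentration of a path sum over a set `C` of paths with few additive coincidences. -/
theorem pathSum_anticoncentration (xY : Y → ZMod 2) (c : P → ZMod 2)
    (N : (Y → ZMod 2) →+ (P → ZMod 2)) (C : Finset (Y → ZMod 2)) (hC : C.Nonempty)
    (d : Y → ZMod 2) (δ : ℝ) (hδ0 : 0 ≤ δ) (hδ : δ ≤ 1 / 2)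
    (hδ' : (2 + (C.card : ℝ) * δ) / 12 ≤ (1 / 2 - δ) ^ 2)
    (h1 : ∀ z₁ ∈ C, ∀ z₂ ∈ C, ∀ z₃ ∈ C, (∀ y, z₁ y = z₂ y → z₁ y = z₃ y) → z₁ = z₃ ∨ z₂ = z₃)
    (h2 : ∀ z₁ ∈ C, ∀ z₂ ∈ C, ∀ z₃ ∈ C, ∀ z₄ ∈ C, N (z₁ + z₂ + z₃ + z₄) = 0 →
      z₁ + z₂ + z₃ + z₄ = 0 ∨ (z₁ + z₂ + z₃ + z₄ = d ∧
        √(9 / 20) ^ (Finset.univ.filter fun y => d y ≠ 0).card ≤ δ)) :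
    (Fintype.card ((P → ZMod 2) × (Y → Fin 4)) : ℝ) / 12 ≤
      ((Finset.univ.filter fun β => (C.card : ℝ) / 2 ≤
        ‖∑ z ∈ C, pathTerm xY c N β z‖ ^ 2).card : ℝ) := by
  classical
  set F : ℝ := (Fintype.card ((P → ZMod 2) × (Y → Fin 4)) : ℝ) with hF
  set T := pathTerm xY c N with hT
  set W := pathCorr xY c N with hW
  have hF0 : 0 ≤ F := Nat.cast_nonneg _
  have hM : (0 : ℝ) < C.card := by exact_mod_cast hC.card_pos
  have hTT : ∀ β z, T β z * conj (T β z) = 1 := fun β z => by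
    rw [Complex.mul_conj, Complex.normSq_eq_norm_sq, hT, norm_pathTerm]; simp
  have hWF : ∀ z₁ z₂ z₃ z₄, ‖W z₁ z₂ z₃ z₄‖ ≤ F := fun z₁ z₂ z₃ z₄ => by
    refine (norm_sum_le _ _).trans ?_
    simp [norm_pathTerm, hF]
  have hnsq : ∀ β, ((‖∑ z ∈ C, T β z‖ ^ 2 : ℝ) : ℂ) =
      ∑ z₁ ∈ C, ∑ z₃ ∈ C, T β z₁ * conj (T β z₃) := fun β => by
    rw [← Complex.normSq_eq_norm_sq, Complex.normSq_eq_conj_mul_self, mul_comm, map_sum,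
      Finset.sum_mul_sum]
  have h11 : ∀ z : Y → ZMod 2, ∀ z' : Y → ZMod 2, z + z + z' + z = z + z' := fun z z' => by
    rw [pi_add_self, zero_add, add_comm]
  have hδF : 0 ≤ F * δ := mul_nonneg hF0 hδ0
  have hd : ∀ z₁ z₂ z₃ z₄ : Y → ZMod 2, z₁ + z₂ + z₃ + z₄ = d →
      √(9 / 20) ^ (Finset.univ.filter fun y => d y ≠ 0).card ≤ δ → ‖W z₁ z₂ z₃ z₄‖ ≤ F * δ := by
    intro z₁ z₂ z₃ z₄ h hτ
    refine (norm_pathCorr_le xY c N z₁ z₂ z₃ z₄).trans ?_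
    rw [h]
    gcongr
  refine paley_zygmund_count (fun β => ‖∑ z ∈ C, T β z‖ ^ 2) C.card δ hM
    hδ hδ' hδ0 ?_ ?_
  -- Since the terms are unimodular, a second-order correlation is the fourth-order one with z₁
  -- inserted twice, so the same estimates serve both moments.
  · have hre : ∑ β, ‖∑ z ∈ C, T β z‖ ^ 2 = ∑ z₁ ∈ C, ∑ z₃ ∈ C, (W z₁ z₁ z₃ z₁).re := by
      have : ((∑ β, ‖∑ z ∈ C, T β z‖ ^ 2 : ℝ) : ℂ) = ∑ z₁ ∈ C, ∑ z₃ ∈ C, W z₁ z₁ z₃ z₁ := by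
        rw [Complex.ofReal_sum]
        simp only [hnsq, hW, pathCorr]
        rw [Finset.sum_comm]
        refine Finset.sum_congr rfl fun z₁ _ => ?_
        rw [Finset.sum_comm]
        refine Finset.sum_congr rfl fun z₃ _ => Finset.sum_congr rfl fun β _ => ?_
        linear_combination (-(T β z₁ * conj (T β z₃))) * hTT β z₁
      rw [← Complex.ofReal_re (∑ β, ‖∑ z ∈ C, T β z‖ ^ 2), this]
      simp only [Complex.re_sum]
    -- Off the diagonal only the partner of z₁ at difference d can correlate with it, at a cost of
    -- at most δ.
    have hpt : ∀ z₁ ∈ C, ∀ z₃ ∈ C, (if z₃ = z₁ then F else 0) - (if z₃ = d - z₁ then F * δ else 0) ≤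
        (W z₁ z₁ z₃ z₁).re := by
      intro z₁ hz₁ z₃ hz₃
      have habs := Complex.abs_re_le_norm (W z₁ z₁ z₃ z₁)
      by_cases h31 : z₃ = z₁
      · subst h31
        have : W z₃ z₃ z₃ z₃ = F := by
          simp only [hW, pathCorr, ← hT]
          rw [Finset.sum_congr rfl fun β _ => show _ = (1 : ℂ) by
            linear_combination (1 + T β z₃ * conj (T β z₃)) * hTT β z₃]
          simp [hF]
        rw [this, if_pos rfl, Complex.ofReal_re]
        split_ifs <;> linarith
      · rw [if_neg h31]
        by_cases hN : N (z₁ + z₁ + z₃ + z₁) = 0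
        · rcases h2 z₁ hz₁ z₁ hz₁ z₃ hz₃ z₁ hz₁ hN with h | ⟨h, hτ⟩
          · rw [h11] at h
            exact absurd (by rw [← add_zero z₃, ← pi_add_self z₁, ← add_assoc, add_comm z₃, h,
              zero_add]) h31
          · have h' := hd _ _ _ _ h hτ
            rw [h11] at h
            rw [if_pos (by rw [← h]; abel)]
            linarith [neg_abs_le (W z₁ z₁ z₃ z₁).re]
        · rw [hW, pathCorr_eq_zero_of_sign _ _ _ _ _ _ _ hN]
          split_ifs <;> simp [hδF]
    rw [hre]
    calc F * C.card * (1 - δ) = ∑ z₁ ∈ C, (F - F * δ) := by simp; ring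
      _ ≤ ∑ z₁ ∈ C, ∑ z₃ ∈ C, ((if z₃ = z₁ then F else 0) - (if z₃ = d - z₁ then F * δ else 0)) := by
          refine Finset.sum_le_sum fun z₁ hz₁ => ?_
          rw [Finset.sum_sub_distrib, Finset.sum_ite_eq', Finset.sum_ite_eq', if_pos hz₁]
          split_ifs <;> linarith
      _ ≤ _ := Finset.sum_le_sum fun z₁ hz₁ => Finset.sum_le_sum fun z₃ hz₃ => hpt z₁ hz₁ z₃ hz₃
  · have hre : ∑ β, (‖∑ z ∈ C, T β z‖ ^ 2) ^ 2 =
        ∑ z₁ ∈ C, ∑ z₃ ∈ C, ∑ z₂ ∈ C, ∑ z₄ ∈ C, (W z₁ z₂ z₃ z₄).re := by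
      have : ((∑ β, (‖∑ z ∈ C, T β z‖ ^ 2) ^ 2 : ℝ) : ℂ) =
          ∑ z₁ ∈ C, ∑ z₃ ∈ C, ∑ z₂ ∈ C, ∑ z₄ ∈ C, W z₁ z₂ z₃ z₄ := by
        rw [Complex.ofReal_sum]
        simp only [Complex.ofReal_pow (‖∑ z ∈ C, T _ z‖ ^ 2), hnsq, hW, pathCorr]
        simp only [pow_two, Finset.sum_mul, Finset.mul_sum]
        rw [Finset.sum_comm]
        refine Finset.sum_congr rfl fun z₁ _ => ?_
        rw [Finset.sum_comm]
        refine Finset.sum_congr rfl fun z₃ _ => ?_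
        rw [Finset.sum_comm]
        refine Finset.sum_congr rfl fun z₂ _ => ?_
        rw [Finset.sum_comm]
        refine Finset.sum_congr rfl fun z₄ _ => Finset.sum_congr rfl fun β _ => ?_
        ring
      rw [← Complex.ofReal_re (∑ β, (‖∑ z ∈ C, T β z‖ ^ 2) ^ 2), this]
      simp only [Complex.re_sum]
    have hadd : ∀ {a b c s x : Y → ZMod 2}, a + b + c + x = s → x = s - (a + b + c) := by
      rintro a b c s x rfl; abel
    have hpt : ∀ z₁ ∈ C, ∀ z₃ ∈ C, ∀ z₂ ∈ C, ∀ z₄ ∈ C, (W z₁ z₂ z₃ z₄).re ≤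
        ((if z₄ = z₂ then (if z₁ = z₃ then F else 0) else 0) +
          (if z₄ = z₁ then (if z₂ = z₃ then F else 0) else 0)) +
        (if z₄ = d - (z₁ + z₂ + z₃) then F * δ else 0) := by
      intro z₁ hz₁ z₃ hz₃ z₂ hz₂ z₄ hz₄
      have hre := Complex.re_le_norm (W z₁ z₂ z₃ z₄)
      have hWF' := hWF z₁ z₂ z₃ z₄
      have n1 : 0 ≤ (if z₄ = z₂ then (if z₁ = z₃ then F else 0) else 0) := by
        split_ifs <;> first | exact hF0 | exact le_rfl
      have n2 : 0 ≤ (if z₄ = z₁ then (if z₂ = z₃ then F else 0) else 0) := by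
        split_ifs <;> first | exact hF0 | exact le_rfl
      have n3 : 0 ≤ (if z₄ = d - (z₁ + z₂ + z₃) then F * δ else 0) := by
        split_ifs <;> first | exact hδF | exact le_rfl
      by_cases hW0 : W z₁ z₂ z₃ z₄ = 0
      · rw [hW0, Complex.zero_re]; linarith
      have hN : N (z₁ + z₂ + z₃ + z₄) = 0 := by
        by_contra hN; exact hW0 (pathCorr_eq_zero_of_sign _ _ _ _ _ _ _ hN)
      rcases h2 z₁ hz₁ z₂ hz₂ z₃ hz₃ z₄ hz₄ hN with h | ⟨h, hτ⟩
      · have h4 := hadd h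
        -- As the four paths sum to zero, z₁ = z₂ at a site implies z₃ = z₄ there; a nonzero
        -- correlation then excludes z₁ ≠ z₃.
        have h13 : ∀ y, z₁ y = z₂ y → z₁ y = z₃ y := by
          intro y h12
          by_contra h13
          refine hW0 (pathCorr_eq_zero_of_phase xY c N z₁ z₂ z₃ z₄ y h12 ?_ h13)
          rw [h4]
          simp only [Pi.sub_apply, Pi.add_apply, Pi.zero_apply, h12]
          generalize z₂ y = a
          generalize z₃ y = b
          revert a b; decide
        rcases h1 z₁ hz₁ z₂ hz₂ z₃ hz₃ h13 with h' | h'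
        · have : z₄ = z₂ := by
            rw [h4, ← h', add_right_comm, pi_add_self, zero_add, zero_sub, neg_eq_of_add_eq_zero_left]
            exact pi_add_self z₂
          rw [if_pos this, if_pos h'] at *
          linarith
        · have : z₄ = z₁ := by
            rw [h4, ← h', add_assoc, pi_add_self, add_zero, zero_sub, neg_eq_of_add_eq_zero_left]
            exact pi_add_self z₁
          rw [if_pos this, if_pos h'] at *
          linarith
      · have := hd _ _ _ _ h hτ
        rw [if_pos (hadd h)] at *
        linarith
    rw [hre]
    -- For each triple (z₁, z₃, z₂) at most one z₄ gives the exceptional sum d, which produces the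
    -- M³δ term.
    calc _ ≤ ∑ z₁ ∈ C, ∑ z₃ ∈ C, ∑ z₂ ∈ C, (((if z₁ = z₃ then F else 0) +
          (if z₂ = z₃ then F else 0)) + F * δ) := by
          refine Finset.sum_le_sum fun z₁ hz₁ => Finset.sum_le_sum fun z₃ hz₃ =>
            Finset.sum_le_sum fun z₂ hz₂ => (Finset.sum_le_sum fun z₄ hz₄ =>
              hpt z₁ hz₁ z₃ hz₃ z₂ hz₂ z₄ hz₄).trans ?_
          rw [Finset.sum_add_distrib, Finset.sum_add_distrib, Finset.sum_ite_eq',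
            Finset.sum_ite_eq', Finset.sum_ite_eq', if_pos hz₁, if_pos hz₂]
          gcongr
          split_ifs
          · exact le_rfl
          · exact hδF
      _ = F * C.card ^ 2 * (2 + C.card * δ) := by
          simp only [Finset.sum_add_distrib, Finset.sum_const, nsmul_eq_mul]
          have a1 : ∑ z₁ ∈ C, ∑ z₃ ∈ C, (C.card : ℝ) * (if z₁ = z₃ then F else 0) =
              C.card * (C.card * F) := by
            rw [Finset.sum_congr rfl fun z₁ hz₁ => show _ = (C.card : ℝ) * F by
              rw [← Finset.mul_sum, Finset.sum_ite_eq, if_pos hz₁]]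
            simp
          have a2 : ∑ z₃ ∈ C, ∑ z₂ ∈ C, (if z₂ = z₃ then F else 0) = C.card * F := by
            rw [Finset.sum_congr rfl fun z₃ hz₃ => show _ = F by
              rw [Finset.sum_ite_eq', if_pos hz₃]]
            simp
          rw [a1, a2]
          ring

end Count

/-! ### The parity checks on the lattice, and the transposition network behind them -/

/-- The sum of the neighbours of `(i, j)` in the interaction graph, where `i + j` is odd. -/
def stencil (Z : ℕ → ℕ → ZMod 2) (i j : ℕ) : ZMod 2 :=
  Z i (j - 1) + Z i (j + 1) + (if j % 4 = 2 then 0 else Z (i - 1) j) +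
    (if j % 4 = 0 then 0 else Z (i + 1) j)

/-- `Z` vanishes outside the sites `(i, j)` of the lattice with `i + j` even. -/
def IsSupported (m : ℕ) (Z : ℕ → ℕ → ZMod 2) : Prop :=
  ∀ i j, ¬ (1 ≤ i ∧ i ≤ m ∧ 1 ≤ j ∧ j ≤ 2 * m + 1 ∧ (i + j) % 2 = 0) → Z i j = 0

/-- `Z` satisfies the parity checks at all blue sites. -/
def IsParityFree (m : ℕ) (Z : ℕ → ℕ → ZMod 2) : Prop :=
  ∀ i j, 1 ≤ i → i ≤ m → 2 ≤ j → j ≤ 2 * m → (i + j) % 2 = 1 → stencil Z i j = 0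

/-- `Z` records the passage of the particles `f` through the odd-even transposition network: the
odd rows show single particles, the even rows show the sum of two particles that meet. -/
structure IsOrbit (m : ℕ) (Z : ℕ → ℕ → ZMod 2) (f : ℤ → ZMod 2) : Prop where
  periodic : ∀ a, f (a + 2 * m) = f a
  odd_row : ∀ t, t ≤ m → ∀ i, 1 ≤ i → i ≤ m → i % 2 = 1 →
    Z i (2 * t + 1) = if t % 2 = 0 then f (i - t) else f (1 - i - t)
  even_row : ∀ t, 1 ≤ t → t ≤ m → ∀ e, 1 ≤ e → e ≤ m → e % 2 = 0 →
    Z e (2 * t) = if t % 2 = 1 then f (e - t) + f (2 - e - t)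
      else f (1 - e - t) + (if e + 1 ≤ m then f (e + 1 - t) else 0)

lemma zmod_two_eq_of_add_eq_zero {a b : ZMod 2} (h : a + b = 0) : b = a := by
  revert a b; decide

theorem exists_isOrbit (m : ℕ) (Z : ℕ → ℕ → ZMod 2) (hs : IsSupported m Z)
    (hk : IsParityFree m Z) : ∃ f, IsOrbit m Z f := by
  -- The value of the particle that starts in row n. In an even row the site in column 2 shows this
  -- particle plus the one from the odd row above, which is subtracted. Particles from odd rows n
  -- get the label n, those from even rows the label 1 - n.
  set p : ℕ → ZMod 2 := fun n => if n % 2 = 1 then Z n 1 else Z n 2 + Z (n - 1) 1 with hp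
  set f : ℤ → ZMod 2 := fun a =>
    if a % (2 * m) ≤ m then p (a % (2 * m)).toNat else p (2 * m + 1 - a % (2 * m)).toNat with hf
  have hper : ∀ a, f (a + 2 * m) = f a := fun a => by simp [hf]
  have f1 : ∀ i : ℕ, 1 ≤ i → i ≤ m → f i = p i := by
    intro i h1 h2
    have : (i : ℤ) % (2 * m) = i := Int.emod_eq_of_lt (by omega) (by omega)
    simp only [hf, this]
    rw [if_pos (by omega)]
    simp
  have f2 : ∀ i : ℕ, 2 ≤ i → i ≤ m → f (1 - i) = p i := by
    intro i h1 h2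
    have : (1 - (i : ℤ)) % (2 * m) = 2 * m + 1 - i := by
      rw [← Int.add_emod_right]
      rw [Int.emod_eq_of_lt (by omega) (by omega)]; ring
    simp only [hf, this]
    rw [if_neg (by omega)]
    congr 1
    omega
  clear_value f
  have key : ∀ t, t ≤ m → (∀ i, 1 ≤ i → i ≤ m → i % 2 = 1 →
      Z i (2 * t + 1) = if t % 2 = 0 then f (i - t) else f (1 - i - t)) ∧
      (1 ≤ t → ∀ e, 1 ≤ e → e ≤ m → e % 2 = 0 →
        Z e (2 * t) = if t % 2 = 1 then f (e - t) + f (2 - e - t)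
          else f (1 - e - t) + (if e + 1 ≤ m then f (e + 1 - t) else 0)) := by
    intro t
    induction t with
    | zero =>
      refine fun _ => ⟨fun i h1 h2 h3 => ?_, fun h => absurd h (by omega)⟩
      simp [f1 i h1 h2, hp, h3]
    | succ t ih =>
      intro ht
      obtain ⟨hA, hB⟩ := ih (by omega)
      -- The even rows in column 2(t+1) follow from the check at (e, 2t+1). For t = 0 there is no
      -- such check, and the formula holds by the choice of `p`.
      have hB' : ∀ e, 1 ≤ e → e ≤ m → e % 2 = 0 →
          Z e (2 * (t + 1)) = if t % 2 = 0 then f (e - t - 1) + f (1 - e - t)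
          else f (- e - t) + (if e + 1 ≤ m then f (e - t) else 0) := by
        intro e h1 h2 h3
        rcases Nat.eq_zero_or_pos t with rfl | htp
        · have e1 : f ((e : ℤ) - 1) = Z (e - 1) 1 := by
            have := f1 (e - 1) (by omega) (by omega)
            rw [Nat.cast_sub h1, Nat.cast_one] at this
            rw [this, hp]
            simp only
            rw [if_pos (by omega)]
          have e2 := f2 e (by omega) h2
          simp only [hp] at e2
          rw [if_neg (by omega)] at e2
          simp only [Nat.cast_zero, sub_zero, e1, e2]
          rw [if_pos (by norm_num)]
          generalize Z (e - 1) 1 = a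
          generalize Z e 2 = b
          revert a b; decide
        · have hst := hk e (2 * t + 1) h1 h2 (by omega) (by omega) (by omega)
          have hb := hB htp e h1 h2 h3
          have ha := hA (e - 1) (by omega) (by omega) (by omega)
          rw [Nat.cast_sub h1, Nat.cast_one] at ha
          unfold stencil at hst
          rw [if_neg (by omega), if_neg (by omega), Nat.add_sub_cancel, hb, ha,
            show 2 * t + 1 + 1 = 2 * (t + 1) by ring] at hst
          by_cases hem : e + 1 ≤ m
          · have ha' := hA (e + 1) (by omega) (by omega) (by omega)
            rw [ha'] at hst
            push_cast at hst
            rcases Nat.mod_two_eq_zero_or_one t with h | h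
            · rw [if_neg (by omega), if_pos h, if_pos h, if_pos hem] at hst
              rw [if_pos h]
              rw [show (e : ℤ) - t - 1 = e - 1 - t by ring]
              generalize Z e (2 * (t + 1)) = w at *
              generalize f (1 - e - t) = u at *
              generalize f (e - 1 - t) = v at *
              generalize f (e + 1 - t) = v' at *
              clear * - hst
              revert w u v v'; decide
            · rw [if_pos h, if_neg (by omega), if_neg (by omega)] at hst
              rw [if_neg (by omega), if_pos hem]
              rw [show (1 : ℤ) - (e - 1) - t = 2 - e - t by ring,
                show (1 : ℤ) - (e + 1) - t = - e - t by ring] at hst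
              generalize Z e (2 * (t + 1)) = w at *
              generalize f (e - t) = u at *
              generalize f (2 - e - t) = v at *
              generalize f (-e - t) = v' at *
              clear * - hst
              revert w u v v'; decide
          · rw [hs (e + 1) _ (by omega)] at hst
            have hme : (e : ℤ) = m := by omega
            rcases Nat.mod_two_eq_zero_or_one t with h | h
            · rw [if_neg (by omega), if_pos h, if_neg hem] at hst
              rw [if_pos h]
              rw [show (e : ℤ) - t - 1 = e - 1 - t by ring]
              generalize Z e (2 * (t + 1)) = w at *
              generalize f (1 - e - t) = u at *
              generalize f (e - 1 - t) = v at *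
              clear * - hst
              revert w u v; decide
            · rw [if_pos h, if_neg (by omega)] at hst
              rw [if_neg (by omega), if_neg hem]
              rw [show (1 : ℤ) - (e - 1) - t = 2 - e - t by ring] at hst
              -- Reflection at the bottom row is the identification of labels modulo 2m.
              have hq : f (-e - t) = f (e - t) := by
                rw [← hper (-e - t), hme]; congr 1; ring
              rw [hq]
              generalize Z e (2 * (t + 1)) = w at *
              generalize f (e - t) = u at *
              generalize f (2 - e - t) = v at *
              clear * - hst
              revert w u v; decide
      refine ⟨fun i h1 h2 h3 => ?_, fun _ e h1 h2 h3 => ?_⟩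
      -- A check in an odd row keeps only one vertical neighbour: the lower one for even t, the
      -- upper one for odd t. That neighbour shows the sum of the two particles which are being
      -- exchanged.
      · have hst := hk i (2 * (t + 1)) h1 h2 (by omega) (by omega) (by omega)
        have ha := hA i h1 h2 h3
        unfold stencil at hst
        rw [show 2 * (t + 1) - 1 = 2 * t + 1 by omega, ha] at hst
        push_cast
        rcases Nat.mod_two_eq_zero_or_one t with h | h
        · rw [if_pos h, if_pos (by omega), if_neg (by omega), add_zero] at hst
          rw [if_neg (by omega), show (1 : ℤ) - i - (t + 1) = - i - t by ring]
          by_cases him : i + 1 ≤ m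
          · rw [hB' (i + 1) (by omega) him (by omega), if_pos h] at hst
            push_cast at hst
            rw [show (i : ℤ) + 1 - t - 1 = i - t by ring,
              show (1 : ℤ) - (i + 1) - t = - i - t by ring] at hst
            generalize Z i (2 * (t + 1) + 1) = w at *
            generalize f (i - t) = u at *
            generalize f (- i - t) = v at *
            clear * - hst
            revert w u v; decide
          · rw [hs (i + 1) _ (by omega), add_zero] at hst
            have hmi : (i : ℤ) = m := by omega
            have hq : f (-i - t) = f (i - t) := by
              rw [← hper (-i - t), hmi]; congr 1; ring
            rw [hq]
            exact zmod_two_eq_of_add_eq_zero hst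
        · rw [if_neg (by omega), if_neg (by omega), if_pos (by omega), add_zero] at hst
          rw [if_pos (by omega)]
          by_cases hi1 : 2 ≤ i
          · rw [hB' (i - 1) (by omega) (by omega) (by omega), if_neg (by omega),
              if_pos (by omega), Nat.cast_sub h1] at hst
            push_cast at hst
            rw [show -((i : ℤ) - 1) - t = 1 - i - t by ring,
              show (i : ℤ) - 1 - t = i - (t + 1) by ring] at hst
            generalize Z i (2 * (t + 1) + 1) = w at *
            generalize f (i - (t + 1)) = u at *
            generalize f (1 - i - t) = v at *
            clear * - hst
            revert w u v; decide
          · obtain rfl : i = 1 := by omega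
            rw [hs (1 - 1) _ (by omega), add_zero] at hst
            rw [zmod_two_eq_of_add_eq_zero hst]
            congr 1
            push_cast
            ring
      · rw [hB' e h1 h2 h3]
        push_cast
        rcases Nat.mod_two_eq_zero_or_one t with h | h
        · rw [if_pos h, if_pos (show (t + 1) % 2 = 1 by omega),
            show (e : ℤ) - t - 1 = e - (t + 1) by ring,
            show (1 : ℤ) - e - t = 2 - e - (t + 1) by ring]
        · rw [if_neg (show ¬ t % 2 = 0 by omega), if_neg (show ¬ (t + 1) % 2 = 1 by omega),
            show (1 : ℤ) - e - (t + 1) = - e - t by ring, show (e : ℤ) + 1 - (t + 1) = e - t by ring]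
  exact ⟨f, hper, fun t ht => (key t ht).1, fun t ht0 ht => (key t ht).2 ht0⟩

/-- Only odd labels ever appear in the orbit formulas; the values of f at even integers carry no
information. -/
lemma IsOrbit.eq {m : ℕ} {Z Z' : ℕ → ℕ → ZMod 2} {f f' : ℤ → ZMod 2} (hZ : IsSupported m Z)
    (hZ' : IsSupported m Z') (h : IsOrbit m Z f) (h' : IsOrbit m Z' f')
    (hff : ∀ a : ℤ, a % 2 = 1 → f a = f' a) : Z = Z' := by
  funext i j
  by_cases hin : 1 ≤ i ∧ i ≤ m ∧ 1 ≤ j ∧ j ≤ 2 * m + 1 ∧ (i + j) % 2 = 0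
  swap
  · rw [hZ i j hin, hZ' i j hin]
  obtain ⟨h1, h2, h3, h4, h5⟩ := hin
  rcases Nat.mod_two_eq_zero_or_one i with hi | hi
  · obtain ⟨t, rfl⟩ : ∃ t, j = 2 * t := ⟨j / 2, by omega⟩
    rw [h.even_row t (by omega) (by omega) i h1 h2 hi,
      h'.even_row t (by omega) (by omega) i h1 h2 hi]
    split_ifs
    · rw [hff _ (by omega), hff _ (by omega)]
    · rw [hff _ (by omega), hff _ (by omega)]
    · rw [hff _ (by omega)]
  · obtain ⟨t, rfl⟩ : ∃ t, j = 2 * t + 1 := ⟨j / 2, by omega⟩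
    rw [h.odd_row t (by omega) i h1 h2 hi, h'.odd_row t (by omega) i h1 h2 hi]
    split_ifs
    · rw [hff _ (by omega)]
    · rw [hff _ (by omega)]

lemma isOrbit_zero (m : ℕ) : IsOrbit m 0 0 := by
  constructor <;> intros <;> simp

lemma isSupported_zero (m : ℕ) : IsSupported m 0 := fun _ _ _ => rfl

lemma IsOrbit.congr {m : ℕ} {Z : ℕ → ℕ → ZMod 2} {f : ℤ → ZMod 2} (h : IsOrbit m Z f) {a b : ℤ}
    (hab : (2 * m : ℤ) ∣ a - b) : f a = f b := by
  obtain ⟨k, hk⟩ := hab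
  have hp : Function.Periodic f (2 * m : ℤ) := h.periodic
  have := hp.int_mul k b
  rw [← this]
  congr 1
  push_cast
  linear_combination hk

/-! ### Visibility of single particles and of pairs -/

/-- Every particle is seen alone at some site. -/
lemma exists_site_single (m : ℕ) (hm : 1 ≤ m) (a : ℤ) (ha : a % 2 = 1) :
    ∃ i j, ∀ Z f, IsOrbit m Z f → Z i j = f a := by
  have hr0 := Int.emod_nonneg a (show (2 * m : ℤ) ≠ 0 by omega)
  have hr1 := Int.emod_lt_of_pos a (show (0 : ℤ) < 2 * m by omega)
  have hr2 : (2 * m : ℤ) ∣ a % (2 * m) - a := by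
    rw [← dvd_neg, neg_sub]; exact Int.dvd_self_sub_emod
  obtain ⟨r, hr⟩ := Int.eq_ofNat_of_zero_le hr0
  rw [hr] at hr1 hr2
  have hr3 : r % 2 = 1 := by
    obtain ⟨k, hk⟩ := hr2
    have : (r : ℤ) = a + 2 * (m * k) := by linear_combination hk
    omega
  -- Labels up to m are visible in column 1; the others move up and stand in the odd row 2m - r in
  -- column 3.
  by_cases hrm : r ≤ m
  · refine ⟨r, 2 * 0 + 1, fun Z f h => ?_⟩
    rw [h.odd_row 0 (by omega) r (by omega) hrm hr3, if_pos (by norm_num), Nat.cast_zero, sub_zero]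
    exact h.congr hr2
  · refine ⟨2 * m - r, 2 * 1 + 1, fun Z f h => ?_⟩
    rw [h.odd_row 1 hm _ (by omega) (by omega) (by omega), if_neg (by norm_num)]
    refine h.congr ?_
    rw [Nat.cast_sub (by omega)]
    push_cast
    rw [show (1 : ℤ) - (2 * m - r) - 1 - a = (r - a) - 2 * m by ring]
    exact dvd_sub_self_right.2 hr2

/-- Any two particles meet. -/
lemma exists_site_pair (m : ℕ) (hm : 1 ≤ m) (a b : ℤ) (ha : a % 2 = 1) (hb : b % 2 = 1)
    (hab : ¬ (2 * m : ℤ) ∣ a - b) : ∃ i j, ∀ Z f, IsOrbit m Z f → Z i j = f a + f b := by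
  -- Particles a and b meet after the time s with a ≡ i - s and b ≡ -i - s modulo 2m for some row i,
  -- so s is determined modulo m by a + b ≡ -2s.
  obtain ⟨c, hc⟩ : ∃ c : ℤ, a + b = -(2 * c) := ⟨-((a + b) / 2), by omega⟩
  have hs0 := Int.emod_nonneg c (show (m : ℤ) ≠ 0 by omega)
  have hs1 := Int.emod_lt_of_pos c (show (0 : ℤ) < m by omega)
  have hs2 : (m : ℤ) ∣ c - c % m := Int.dvd_self_sub_emod
  obtain ⟨s, hs⟩ := Int.eq_ofNat_of_zero_le hs0
  rw [hs] at hs1 hs2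
  have hsum : (2 * m : ℤ) ∣ a + b + 2 * s := by
    obtain ⟨k, hk⟩ := hs2
    exact ⟨-k, by linear_combination hc - 2 * hk⟩
  clear hs hs0 hs2 hc c
  have main : ∀ a b : ℤ, a % 2 = 1 → b % 2 = 1 → (2 * m : ℤ) ∣ a + b + 2 * s →
      ∀ i : ℕ, 1 ≤ i → i < m → (2 * m : ℤ) ∣ a + s - i →
      ∃ i j, ∀ Z f, IsOrbit m Z f → Z i j = f a + f b := by
    intro a b ha hb hsum i hi1 him hi
    have hpar : (i + s) % 2 = 1 := by
      obtain ⟨k, hk⟩ := hi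
      have : a + s - i = 2 * (m * k) := by linear_combination hk
      omega
    have hi' : (2 * m : ℤ) ∣ b + i + s := by
      have := dvd_sub hsum hi
      rwa [show a + b + 2 * s - (a + s - i) = b + i + s by ring] at this
    have hi_neg : (2 * m : ℤ) ∣ i - s - a := by
      rw [← dvd_neg, show -(i - s - a : ℤ) = a + s - i by ring]; exact hi
    have hi'_neg : (2 * m : ℤ) ∣ - i - s - b := by
      rw [← dvd_neg, show -(-i - s - b : ℤ) = b + i + s by ring]; exact hi'
    rcases Nat.mod_two_eq_zero_or_one s with h | h
    · refine ⟨i + 1, 2 * (s + 1), fun Z f hZ => ?_⟩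
      rw [hZ.even_row (s + 1) (by omega) (by omega) (i + 1) (by omega) (by omega) (by omega),
        if_pos (by omega)]
      push_cast
      rw [show (i : ℤ) + 1 - (s + 1) = i - s by ring,
        show (2 : ℤ) - (i + 1) - (s + 1) = -i - s by ring, hZ.congr hi_neg, hZ.congr hi'_neg]
    · refine ⟨i, 2 * (s + 1), fun Z f hZ => ?_⟩
      rw [hZ.even_row (s + 1) (by omega) (by omega) i (by omega) (by omega) (by omega),
        if_neg (by omega), if_pos (by omega)]
      push_cast
      rw [show (i : ℤ) + 1 - (s + 1) = i - s by ring,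
        show (1 : ℤ) - i - (s + 1) = -i - s by ring, hZ.congr hi_neg, hZ.congr hi'_neg, add_comm]
  have hr0 := Int.emod_nonneg (a + s) (show (2 * m : ℤ) ≠ 0 by omega)
  have hr1 := Int.emod_lt_of_pos (a + s) (show (0 : ℤ) < 2 * m by omega)
  have hr2 : (2 * m : ℤ) ∣ (a + s) - (a + s) % (2 * m) := Int.dvd_self_sub_emod
  obtain ⟨r, hr⟩ := Int.eq_ofNat_of_zero_le hr0
  rw [hr] at hr1 hr2
  -- The residue r of a + s is the meeting row if 0 < r < m. The values 0 and m are fixed by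
  -- negation modulo 2m and would give a ≡ b; for r > m the two particles change roles.
  rcases Nat.lt_trichotomy r m with h | h | h
  · rcases Nat.eq_zero_or_pos r with rfl | hr3
    · refine absurd ?_ hab
      have h2 : (2 * m : ℤ) ∣ 2 * (a + s - (0 : ℕ)) := Dvd.dvd.mul_left hr2 2
      have := dvd_sub h2 hsum
      rwa [show 2 * (a + s - (0 : ℕ)) - (a + b + 2 * s) = a - b by push_cast; ring] at this
    · exact main a b ha hb hsum r hr3 h hr2
  · refine absurd ?_ hab
    obtain ⟨k, hk⟩ := hr2
    obtain ⟨l, hl⟩ := hsum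
    subst h
    exact ⟨2 * k - l + 1, by linear_combination 2 * hk - hl⟩
  · obtain ⟨i, j, hij⟩ := main b a hb ha (by rwa [add_comm b a]) (2 * m - r) (by omega) (by omega) (by
      rw [Nat.cast_sub (by omega)]
      push_cast
      have := dvd_sub (dvd_sub hsum hr2) (dvd_refl (2 * m : ℤ))
      rwa [show a + b + 2 * s - (a + s - r) - 2 * m = b + s - (2 * m - r) by ring] at this)
    exact ⟨i, j, fun Z f h => (hij Z f h).trans (add_comm _ _)⟩

/-- A parity-free configuration that vanishes wherever `Z` does is trivial or equal to `Z`. -/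
theorem eq_zero_or_eq_of_vanish (m : ℕ) (Z Z' : ℕ → ℕ → ZMod 2) (hs : IsSupported m Z)
    (hk : IsParityFree m Z) (hs' : IsSupported m Z') (hk' : IsParityFree m Z')
    (h : ∀ i j, Z i j = 0 → Z' i j = 0) : Z' = 0 ∨ Z' = Z := by
  rcases Nat.eq_zero_or_pos m with rfl | hm
  · left; funext i j; exact hs' i j (by omega)
  obtain ⟨f, hf⟩ := exists_isOrbit m Z hs hk
  obtain ⟨g, hg⟩ := exists_isOrbit m Z' hs' hk'
  have single : ∀ a : ℤ, a % 2 = 1 → f a = 0 → g a = 0 := by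
    intro a ha h0
    obtain ⟨i, j, hij⟩ := exists_site_single m hm a ha
    rw [← hij Z' g hg]
    exact h i j (by rw [hij Z f hf, h0])
  have pair : ∀ a b : ℤ, a % 2 = 1 → b % 2 = 1 → f a = f b → g a = g b := by
    intro a b ha hb hab
    by_cases hd : (2 * m : ℤ) ∣ a - b
    · exact hg.congr hd
    obtain ⟨i, j, hij⟩ := exists_site_pair m hm a b ha hb hd
    have h0 := h i j (by rw [hij Z f hf, hab, CharTwo.add_self_eq_zero])
    rw [hij Z' g hg] at h0
    exact (zmod_two_eq_of_add_eq_zero h0).symm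
  -- If g is 1 at some a₀, so is f. Wherever f is 1 it agrees with f(a₀), hence g is 1 there as
  -- well; wherever f is 0, so is g.
  by_cases hall : ∀ a : ℤ, a % 2 = 1 → g a = 0
  · left; exact hg.eq hs' (isSupported_zero m) (isOrbit_zero m) hall
  · right
    push Not at hall
    obtain ⟨a₀, ha₀, hga₀⟩ := hall
    refine hg.eq hs' hs hf fun a ha => ?_
    have hfa₀ : f a₀ = 1 := (zmod_two_cases _).resolve_left fun h0 => hga₀ (single a₀ ha₀ h0)
    have hga₀' : g a₀ = 1 := (zmod_two_cases _).resolve_left hga₀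
    rcases zmod_two_cases (f a) with h0 | h1
    · rw [h0, single a ha h0]
    · rw [pair a a₀ ha ha₀ (h1.trans hfa₀.symm), hga₀', h1]

/-- A parity-free configuration is determined by its first two columns. -/
theorem eq_zero_of_first_columns (m : ℕ) (Z : ℕ → ℕ → ZMod 2) (hs : IsSupported m Z)
    (hk : IsParityFree m Z) (h1 : ∀ i, i % 2 = 1 → Z i 1 = 0) (h2 : ∀ i, i % 2 = 0 → Z i 2 = 0) :
    Z = 0 := by
  rcases Nat.eq_zero_or_pos m with rfl | hm
  · funext i j; exact hs i j (by omega)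
  obtain ⟨f, hf⟩ := exists_isOrbit m Z hs hk
  have hodd : ∀ i : ℕ, 1 ≤ i → i ≤ m → i % 2 = 1 → f i = 0 := by
    intro i hi1 him hi
    have := hf.odd_row 0 (by omega) i hi1 him hi
    rw [if_pos (by norm_num)] at this
    simpa [h1 i hi] using this.symm
  have heven : ∀ i : ℕ, 1 ≤ i → i ≤ m → i % 2 = 0 → f (1 - i) = 0 := by
    intro i hi1 him hi
    have := hf.even_row 1 le_rfl hm i hi1 him hi
    rw [if_pos (by norm_num), Nat.mul_one, h2 i hi] at this
    have e := hodd (i - 1) (by omega) (by omega) (by omega)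
    rw [Nat.cast_sub hi1] at e
    rw [Nat.cast_one] at e this
    rw [e, zero_add, show (2 : ℤ) - i - 1 = 1 - i by ring] at this
    exact this.symm
  refine hf.eq hs (isSupported_zero m) (isOrbit_zero m) fun a ha => ?_
  have hr0 := Int.emod_nonneg a (show (2 * m : ℤ) ≠ 0 by omega)
  have hr1 := Int.emod_lt_of_pos a (show (0 : ℤ) < 2 * m by omega)
  have hr2 : (2 * m : ℤ) ∣ a - a % (2 * m) := Int.dvd_self_sub_emod
  rw [hf.congr hr2]
  obtain ⟨r, hr⟩ := Int.eq_ofNat_of_zero_le hr0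
  rw [hr] at hr1 hr2 ⊢
  have hr3 : r % 2 = 1 := by
    obtain ⟨k, hk⟩ := hr2
    have : a = r + 2 * (m * k) := by linear_combination hk
    omega
  by_cases hrm : r ≤ m
  · exact hodd r (by omega) hrm hr3
  · have := heven (2 * m + 1 - r) (by omega) (by omega) (by omega)
    rw [Nat.cast_sub (by omega)] at this
    rw [← hf.periodic] at this
    push_cast at this
    rw [show (1 : ℤ) - (2 * m + 1 - r) + 2 * m = r by ring] at this
    simpa using this

/-! ### The parity checks at the pink sites -/

/-- The configuration with value one in the odd rows. -/
def oddRows (m : ℕ) (i j : ℕ) : ZMod 2 :=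
  if 1 ≤ i ∧ i ≤ m ∧ 1 ≤ j ∧ j ≤ 2 * m + 1 ∧ (i + j) % 2 = 0 ∧ i % 2 = 1 then 1 else 0

/-- The parity checks at the pink sites leave at most one nontrivial configuration. -/
theorem eq_zero_or_eq_oddRows (m : ℕ) (Z : ℕ → ℕ → ZMod 2) (hs : IsSupported m Z)
    (hk : IsParityFree m Z)
    (hl : ∀ e, 1 ≤ e → e ≤ m → e % 2 = 0 → stencil Z e 1 = 0)
    (hr : ∀ e, 1 ≤ e → e ≤ m → e % 2 = 0 → stencil Z e (2 * m + 1) = 0) :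
    Z = 0 ∨ (m % 2 = 1 ∧ Z = oddRows m) := by
  rcases Nat.eq_zero_or_pos m with rfl | hm
  · left; funext i j; exact hs i j (by omega)
  obtain ⟨f, hf⟩ := exists_isOrbit m Z hs hk
  -- At the left end the check equates the particles starting in rows e and e + 1. If row e is the
  -- last one, its particle must vanish; this is what excludes a nonzero constant for even m.
  have hl' : ∀ e : ℕ, 1 ≤ e → e ≤ m → e % 2 = 0 →
      f (1 - e) = if e + 1 ≤ m then f (e + 1) else 0 := by
    intro e h1 h2 h3
    have hst := hl e h1 h2 h3
    have b := hf.even_row 1 le_rfl hm e h1 h2 h3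
    have a := hf.odd_row 0 (by omega) (e - 1) (by omega) (by omega) (by omega)
    unfold stencil at hst
    rw [if_neg (by norm_num), if_neg (by norm_num), hs e (1 - 1) (by omega)] at hst
    rw [if_pos (by norm_num), Nat.cast_sub h1] at a
    rw [if_pos (by norm_num)] at b
    simp only [mul_zero, mul_one, zero_add, Nat.cast_zero, Nat.cast_one, sub_zero] at a b hst
    rw [a, b, show (2 : ℤ) - e - 1 = 1 - e by ring] at hst
    by_cases hem : e + 1 ≤ m
    · have a' := hf.odd_row 0 (by omega) (e + 1) (by omega) (by omega) (by omega)
      rw [if_pos (by norm_num)] at a'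
      push_cast at a'
      simp only [sub_zero] at a'
      rw [a'] at hst
      rw [if_pos hem]
      generalize f (1 - e) = u at *
      generalize f (e - 1) = v at *
      generalize f (e + 1) = w at *
      clear * - hst
      revert u v w; decide
    · rw [hs (e + 1) 1 (by omega)] at hst
      rw [if_neg hem]
      generalize f (1 - e) = u at *
      generalize f (e - 1) = v at *
      clear * - hst
      revert u v; decide
  have hr' : ∀ e : ℕ, 1 ≤ e → e ≤ m → e % 2 = 0 →
      if m % 2 = 1 then f (e - m) = f (-e - m) else f (1 - e - m) = f (e - 1 - m) := by
    intro e h1 h2 h3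
    have hst := hr e h1 h2 h3
    have b := hf.even_row m hm le_rfl e h1 h2 h3
    have a := hf.odd_row m le_rfl (e - 1) (by omega) (by omega) (by omega)
    unfold stencil at hst
    rw [if_neg (by omega), if_neg (by omega), hs e (2 * m + 1 + 1) (by omega), Nat.add_sub_cancel]
      at hst
    rw [Nat.cast_sub h1, Nat.cast_one] at a
    rw [a, b] at hst
    split_ifs with hmo
    · have a' := hf.odd_row m le_rfl (e + 1) (by omega) (by omega) (by omega)
      rw [if_neg (by omega)] at a'
      rw [if_pos hmo, if_neg (by omega), a'] at hst
      push_cast at hst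
      rw [show (1 : ℤ) - (e - 1) - m = 2 - e - m by ring,
        show (1 : ℤ) - (e + 1) - m = - e - m by ring] at hst
      generalize f (e - m) = u at *
      generalize f (2 - e - m) = v at *
      generalize f (-e - m) = w at *
      clear * - hst
      revert u v w; decide
    · rw [if_neg hmo, if_pos (show m % 2 = 0 by omega)] at hst
      by_cases hem : e + 1 ≤ m
      · have a' := hf.odd_row m le_rfl (e + 1) (by omega) (by omega) (by omega)
        rw [if_pos (by omega)] at a'
        push_cast at a'
        rw [if_pos hem, a'] at hst
        generalize f (1 - e - m) = u at *
        generalize f (e + 1 - m) = v at *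
        generalize f (e - 1 - m) = w at *
        clear * - hst
        revert u v w; decide
      · rw [hs (e + 1) _ (by omega), if_neg hem] at hst
        generalize f (1 - e - m) = u at *
        generalize f (e - 1 - m) = w at *
        clear * - hst
        revert u w; decide
  -- Representatives centred at 0 suit the two reflections: the pink checks cover one half of this
  -- window, and the other half follows because reflections are involutions.
  have rep : ∀ a : ℤ, ∃ r : ℤ, - m < r ∧ r ≤ m ∧ (2 * m : ℤ) ∣ a - r := by
    intro a
    refine ⟨(a + m - 1) % (2 * m) - m + 1, ?_, ?_, ?_⟩
    · linarith [Int.emod_nonneg (a + m - 1) (show (2 * m : ℤ) ≠ 0 by omega)]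
    · linarith [Int.emod_lt_of_pos (a + m - 1) (show (0 : ℤ) < 2 * m by omega)]
    · rw [show a - ((a + m - 1) % (2 * m) - m + 1) = (a + m - 1) - (a + m - 1) % (2 * m) by ring]
      exact Int.dvd_self_sub_emod
  have par : ∀ a r : ℤ, a % 2 = 1 → (2 * m : ℤ) ∣ a - r → r % 2 = 1 := by
    rintro a r ha ⟨k, hk⟩
    have : a - r = 2 * (m * k) := by linear_combination hk
    omega
  have negd : ∀ {x y : ℤ}, x = -y → (2 * m : ℤ) ∣ y → (2 * m : ℤ) ∣ x := by
    rintro x y rfl h; exact (dvd_neg).2 h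
  have refl₁ : ∀ a : ℤ, a % 2 = 1 → f (2 - a) = f a := by
    intro a ha
    obtain ⟨r, hr1, hr2, hr3⟩ := rep a
    have hrp := par a r ha hr3
    rw [hf.congr hr3, hf.congr (b := 2 - r) (negd (by ring) hr3)]
    have pos : ∀ r : ℤ, 3 ≤ r → r ≤ m → r % 2 = 1 → f (2 - r) = f r := by
      intro r h1 h2 h3
      obtain ⟨n, rfl⟩ := Int.eq_ofNat_of_zero_le (show 0 ≤ r by omega)
      have := hl' (n - 1) (by omega) (by omega) (by omega)
      rw [if_pos (by omega), Nat.cast_sub (by omega), Nat.cast_one] at this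
      rw [show (1 : ℤ) - (n - 1) = 2 - n by ring, show (n : ℤ) - 1 + 1 = n by ring] at this
      exact this
    rcases lt_trichotomy r 1 with h | rfl | h
    · by_cases h' : 2 - r ≤ m
      · have := pos (2 - r) (by omega) h' (by omega)
        rw [show 2 - (2 - r) = r by ring] at this
        exact this.symm
      -- Here 2 - r = m + 1 lies outside the window, but it is congruent to r, so the label is a
      -- fixed point of the reflection.
      · obtain rfl : r = 1 - m := by omega
        exact hf.congr ⟨1, by ring⟩
    · norm_num
    · exact pos r (by omega) hr2 hrp
  have refl₂ : ∀ a : ℤ, a % 2 = 1 → f (-a) = f a := by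
    intro a ha
    obtain ⟨r, hr1, hr2, hr3⟩ := rep a
    have hrp := par a r ha hr3
    rw [hf.congr hr3, hf.congr (b := -r) (negd (by ring) hr3)]
    have neg : ∀ r : ℤ, r < 0 → -m < r → r % 2 = 1 → f (-r) = f r := by
      intro r h1 h2 h3
      by_cases hmo : m % 2 = 1
      · have := hr' (r + m).toNat (by omega) (by omega) (by omega)
        rw [if_pos hmo, Int.toNat_of_nonneg (by omega)] at this
        rw [show r + m - m = r by ring] at this
        rw [this]
        exact hf.congr ⟨1, by ring⟩
      · have := hr' (r + m + 1).toNat (by omega) (by omega) (by omega)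
        rw [if_neg hmo, Int.toNat_of_nonneg (by omega)] at this
        rw [show r + m + 1 - 1 - m = r by ring] at this
        rw [← this]
        exact hf.congr ⟨1, by ring⟩
    rcases lt_or_ge r 0 with h | h
    · exact neg r h hr1 hrp
    · by_cases hrm : r = m
      · subst hrm
        exact hf.congr ⟨-1, by ring⟩
      · have := neg (-r) (by omega) (by omega) (by omega)
        rw [neg_neg] at this
        exact this.symm
  -- The composite of the two reflections is the translation by 2, which is transitive on the odd
  -- integers.
  have step : ∀ a : ℤ, a % 2 = 1 → f (a + 2) = f a := by
    intro a ha
    rw [← refl₂ a ha, ← refl₁ (-a) (by omega)]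
    congr 1; ring
  have const : ∀ a : ℤ, a % 2 = 1 → f a = f 1 := by
    have up : ∀ n : ℤ, f (2 * n + 1) = f 1 := by
      intro n
      induction n using Int.induction_on with
      | zero => norm_num
      | succ n ih =>
        rw [← ih, ← step (2 * n + 1) (by omega)]; congr 1
      | pred n ih =>
        rw [← ih, ← step _ (by omega)]; congr 1; ring
    intro a ha
    rw [← up (a / 2)]
    congr 1
    omega
  rcases zmod_two_cases (f 1) with h | h
  · left
    exact hf.eq hs (isSupported_zero m) (isOrbit_zero m) fun a ha => (const a ha).trans h
  · have hmo : m % 2 = 1 := by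
      by_contra hmo
      have := hl' m hm le_rfl (by omega)
      rw [if_neg (by omega), const _ (by omega), h] at this
      exact one_ne_zero this
    refine Or.inr ⟨hmo, ?_⟩
    refine hf.eq (f' := fun _ => 1) hs (fun i j hij => if_neg fun h' => hij
      ⟨h'.1, h'.2.1, h'.2.2.1, h'.2.2.2.1, h'.2.2.2.2.1⟩) ⟨fun _ => rfl, ?_, ?_⟩
      fun a ha => (const a ha).trans h
    · intro t ht i h1 h2 h3
      rw [oddRows, if_pos (by omega), ite_self]
    · intro t ht0 ht e h1 h2 h3
      rw [oddRows, if_neg (by omega), if_pos (show e + 1 ≤ m by omega), ite_self]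
      decide

/-! ### The lattice sites -/

/-- Pink sites lie in even rows and odd columns, so they belong to the blue parity class and cost
the yellow class nothing. -/
lemma isYellow_iff {m : ℕ} (v : Site m) : IsYellow v ↔ (row v + col v) % 2 = 0 := by
  unfold IsYellow IsPink
  rw [Nat.even_iff, Nat.even_iff]
  omega

lemma isDirectedEdge_iff {m : ℕ} (u v : Site m) : IsDirectedEdge u v ↔
    (row u = row v ∧ col v = col u + 1) ∨ (col u = col v ∧ row v = row u + 1) := by
  obtain ⟨a, b⟩ := u
  obtain ⟨c, d⟩ := v
  simp only [IsDirectedEdge, lattice, SimpleGraph.boxProd_adj, SimpleGraph.pathGraph_adj,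
    Prod.mk_le_mk, Fin.le_def, Fin.ext_iff, row, col]
  omega

/-- The directed edges of the interaction graph. -/
def IsBond {m : ℕ} (u v : Site m) : Prop := IsDirectedEdge u v ∧ delta u v = 1

lemma IsBond.isYellow_iff_not {m : ℕ} {u v : Site m} (h : IsBond u v) :
    IsYellow u ↔ ¬ IsYellow v := by
  have := (isDirectedEdge_iff u v).1 h.1
  rw [isYellow_iff, isYellow_iff]
  omega

lemma IsBond.asymm {m : ℕ} {u v : Site m} (h : IsBond u v) : ¬ IsBond v u := fun h' => by
  have h1 := (isDirectedEdge_iff u v).1 h.1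
  have h2 := (isDirectedEdge_iff v u).1 h'.1
  omega

lemma IsBond.ne {m : ℕ} {u v : Site m} (h : IsBond u v) : u ≠ v := by
  rintro rfl; exact h.asymm h

open scoped Classical in
lemma degree_interaction {m : ℕ} (v : Site m) [Fintype ((interaction m).neighborSet v)] :
    ((interaction m).degree v : ℝ) =
      ∑ w, ((if IsBond v w then 1 else 0) + (if IsBond w v then 1 else 0)) := by
  have h : (interaction m).degree v =
      (Finset.univ.filter fun w => (interaction m).Adj v w).card := by
    rw [← SimpleGraph.card_neighborFinset_eq_degree]
    congr 1
    ext w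
    simp
  rw [h, Finset.card_filter, Nat.cast_sum]
  refine Finset.sum_congr rfl fun w _ => ?_
  have hadj : (interaction m).Adj v w ↔ (IsBond v w ∨ IsBond w v) := by
    simp only [interaction, SimpleGraph.fromRel_adj]
    exact ⟨fun h => h.2, fun h => ⟨h.elim IsBond.ne fun h => h.ne.symm, h⟩⟩
  by_cases h1 : IsBond v w
  · simp [hadj, h1, h1.asymm]
  · by_cases h2 : IsBond w v <;> simp [hadj, h1, h2]

open scoped Classical in
/-- The sum of a bit assignment over the neighbours of `v` in the interaction graph. -/
noncomputable def nbrSum {m : ℕ} (z : Site m → ZMod 2) (v : Site m) : ZMod 2 :=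
  ∑ w, ((if IsBond v w then z w else 0) + (if IsBond w v then z w else 0))

open scoped Classical in
/-- The number of bonds between occupied sites, modulo 2. -/
noncomputable def bondSum {m : ℕ} (z : Site m → ZMod 2) : ZMod 2 :=
  ∑ u, ∑ v, if IsBond u v then z u * z v else 0

/-- The interaction graph is bipartite: each bond has exactly one end that is not yellow, and it is
counted there. This makes the exponent linear in the blue and pink bits once the yellow bits are
given. -/
lemma bondSum_eq {m : ℕ} (z : Site m → ZMod 2) :
    bondSum z = ∑ v : {v : Site m // ¬ IsYellow v}, z v * nbrSum z v := by
  classical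
  rw [← Finset.sum_subtype (Finset.univ.filter fun v : Site m => ¬ IsYellow v) (by simp)
    (fun v => z v * nbrSum z v), Finset.sum_filter]
  have h : ∀ v, (if ¬ IsYellow v then z v * nbrSum z v else 0) =
      ∑ w, (if IsBond v w then (if ¬ IsYellow v then z v * z w else 0) else 0) +
      ∑ w, (if IsBond w v then (if ¬ IsYellow v then z w * z v else 0) else 0) := by
    intro v
    rw [← Finset.sum_add_distrib]
    by_cases hv : IsYellow v
    · simp [hv]
    · simp only [hv, not_false_eq_true, if_true, nbrSum, Finset.mul_sum]
      refine Finset.sum_congr rfl fun w _ => ?_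
      split_ifs <;> ring
  rw [Finset.sum_congr rfl fun v _ => h v, Finset.sum_add_distrib]
  conv_rhs => rw [add_comm, Finset.sum_comm]
  rw [← Finset.sum_add_distrib, bondSum]
  refine Finset.sum_congr rfl fun u _ => ?_
  rw [← Finset.sum_add_distrib]
  refine Finset.sum_congr rfl fun v _ => ?_
  by_cases hb : IsBond u v
  · have := hb.isYellow_iff_not
    by_cases hv : IsYellow v
    · simp [hb, hv, this]
    · simp [hb, hv, this]
  · simp [hb]

/-! ### The Hamiltonian is diagonal -/

lemma pauliZ_eq : pauliZ = Matrix.diagonal fun a : Fin 2 => sgn a := by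
  ext i j
  fin_cases i <;> fin_cases j <;> simp [pauliZ]
  · exact sgn_zero.symm
  · exact sgn_one.symm

lemma hadamard_apply (a b : Fin 2) :
    hadamard a b = ((1 / √2 : ℝ) : ℂ) * sgn ((a : ZMod 2) * (b : ZMod 2)) := by
  rw [hadamard, Matrix.smul_apply, smul_eq_mul]
  congr 1
  fin_cases a <;> fin_cases b
  · exact sgn_zero.symm
  · exact sgn_zero.symm
  · exact sgn_zero.symm
  · exact sgn_one.symm

lemma Zat_eq {V : Type} [Fintype V] [DecidableEq V] (v : V) :
    Zat v = Matrix.diagonal fun z : Bits V => sgn (z v) := by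
  ext x z
  rw [Zat, tensorOp, Matrix.of_apply]
  by_cases h : x = z
  · subst h
    rw [Matrix.diagonal_apply_eq, Finset.prod_eq_single v]
    · rw [Function.update_self, pauliZ_eq, Matrix.diagonal_apply_eq]
    · intro w _ hw
      rw [Function.update_of_ne hw, Matrix.one_apply_eq]
    · simp
  · rw [Matrix.diagonal_apply_ne _ h]
    obtain ⟨w, hw⟩ := Function.ne_iff.1 h
    refine Finset.prod_eq_zero (Finset.mem_univ w) ?_
    by_cases hwv : w = v
    · subst hwv
      rw [Function.update_self, pauliZ_eq, Matrix.diagonal_apply_ne _ hw]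
    · rw [Function.update_of_ne hwv, Matrix.one_apply_ne hw]

open scoped Classical in
/-- The eigenvalues of the Hamiltonian. -/
noncomputable def energy {m : ℕ} (z : Site m → ZMod 2) : ℂ :=
  ∑ u, ∑ v, if IsBond u v then
    ((Real.pi / 4 : ℝ) : ℂ) * (sgn (z u) * sgn (z v) - sgn (z u) - sgn (z v)) else 0

lemma delta_eq_zero_or_one {m : ℕ} (u v : Site m) : delta u v = 0 ∨ delta u v = 1 := by
  unfold delta
  split_ifs <;> simp

/-- The degree in the linear term lets each bond carry its own share Z_u + Z_v, so the energy is a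
sum over bonds. -/
lemma hamiltonian_eq (m : ℕ) :
    hamiltonian m = Matrix.diagonal fun z : Bits (Site m) => energy (m := m) z := by
  classical
  have hdeg : ∀ z : Site m → ZMod 2,
      ∑ v : Site m, (((Real.pi / 4 * ((interaction m).degree v : ℝ) : ℝ)) : ℂ) * sgn (z v) =
      ∑ u, ∑ v, if IsBond u v then ((Real.pi / 4 : ℝ) : ℂ) * (sgn (z u) + sgn (z v)) else 0 := by
    intro z
    have h1 : ∀ v : Site m,
        (((Real.pi / 4 * ((interaction m).degree v : ℝ) : ℝ)) : ℂ) * sgn (z v) =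
        ∑ w, (if IsBond v w then ((Real.pi / 4 : ℝ) : ℂ) * sgn (z v) else 0) +
        ∑ w, (if IsBond w v then ((Real.pi / 4 : ℝ) : ℂ) * sgn (z v) else 0) := by
      intro v
      rw [degree_interaction, Finset.mul_sum, Complex.ofReal_sum, Finset.sum_mul,
        ← Finset.sum_add_distrib]
      refine Finset.sum_congr rfl fun w _ => ?_
      split_ifs <;> push_cast <;> ring
    rw [Finset.sum_congr rfl fun v _ => h1 v, Finset.sum_add_distrib]
    conv_lhs => rw [add_comm, Finset.sum_comm]
    rw [← Finset.sum_add_distrib]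
    refine Finset.sum_congr rfl fun u _ => ?_
    rw [← Finset.sum_add_distrib]
    refine Finset.sum_congr rfl fun v _ => ?_
    split_ifs <;> ring
  have hen : ∀ z : Site m → ZMod 2, energy z =
      (∑ u : Site m, ∑ v : Site m, if IsDirectedEdge u v then
        (((Real.pi / 4 * delta u v : ℝ)) : ℂ) * (sgn (z u) * sgn (z v)) else 0) -
      ∑ v : Site m, (((Real.pi / 4 * ((interaction m).degree v : ℝ) : ℝ)) : ℂ) * sgn (z v) := by
    intro z
    rw [hdeg, energy, ← Finset.sum_sub_distrib]
    refine Finset.sum_congr rfl fun u _ => ?_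
    rw [← Finset.sum_sub_distrib]
    refine Finset.sum_congr rfl fun v _ => ?_
    by_cases h1 : IsDirectedEdge u v
    · rcases delta_eq_zero_or_one u v with h | h
      · simp [IsBond, h]
      · simp [IsBond, h, h1]; ring
    · simp [IsBond, h1]
  ext x z
  rw [hamiltonian]
  simp only [Zat_eq, Matrix.diagonal_mul_diagonal, Matrix.sub_apply, Matrix.sum_apply]
  by_cases h : x = z
  · subst h
    rw [Matrix.diagonal_apply_eq]
    refine Eq.trans ?_ (hen x).symm
    congr 1
    · refine Finset.sum_congr rfl fun u _ => Finset.sum_congr rfl fun v _ => ?_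
      split_ifs
      · rw [Matrix.smul_apply, Matrix.diagonal_apply_eq, smul_eq_mul]
      · rfl
    · refine Finset.sum_congr rfl fun v _ => ?_
      rw [Matrix.smul_apply, Matrix.diagonal_apply_eq, smul_eq_mul]
  · rw [Matrix.diagonal_apply_ne _ h]
    simp only [Matrix.smul_apply, Matrix.diagonal_apply_ne _ h, smul_zero, Finset.sum_const_zero,
      sub_zero]
    refine Finset.sum_eq_zero fun u _ => Finset.sum_eq_zero fun v _ => ?_
    split_ifs
    · rw [Matrix.smul_apply, Matrix.diagonal_apply_ne _ h, smul_zero]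
    · rfl

lemma exp_hamiltonian (m : ℕ) : NormedSpace.exp ((-Complex.I) • hamiltonian m) =
    Matrix.diagonal fun z : Bits (Site m) => Complex.exp (-Complex.I * energy (m := m) z) := by
  rw [hamiltonian_eq, ← Matrix.diagonal_smul, Matrix.exp_diagonal, Pi.exp_def]
  congr 1
  funext z
  rw [Complex.exp_eq_exp_ℂ]
  rfl

/-- Evolution under the Hamiltonian applies controlled-`Z` gates along the bonds. -/
lemma exists_exp_energy (m : ℕ) : ∃ γ : ℂ, ‖γ‖ = 1 ∧ ∀ z : Site m → ZMod 2,
    Complex.exp (-Complex.I * energy z) = γ * sgn (bondSum z) := by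
  classical
  refine ⟨∏ u : Site m, ∏ v : Site m, if IsBond u v then
    Complex.exp ((Real.pi / 4 : ℝ) * Complex.I) else 1, ?_, fun z => ?_⟩
  · rw [norm_prod]
    refine Finset.prod_eq_one fun u _ => ?_
    rw [norm_prod]
    refine Finset.prod_eq_one fun v _ => ?_
    split_ifs
    · exact Complex.norm_exp_ofReal_mul_I _
    · simp
  · rw [energy, bondSum, sgn_sum, ← Finset.prod_mul_distrib, Finset.mul_sum, Complex.exp_sum]
    refine Finset.prod_congr rfl fun u _ => ?_
    rw [sgn_sum, ← Finset.prod_mul_distrib, Finset.mul_sum, Complex.exp_sum]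
    refine Finset.prod_congr rfl fun v _ => ?_
    split_ifs
    -- On a bond Z_uZ_v - Z_u - Z_v equals -1, except for the value 3 when both bits are 1. The gap
    -- 4 · π/4 = π gives the sign -1.
    · rcases zmod_two_cases (z u) with h | h <;> rcases zmod_two_cases (z v) with h' | h' <;>
        rw [h, h']
      · simp; congr 1; ring
      · simp; congr 1; ring
      · simp; congr 1; ring
      · rw [sgn_one, show -Complex.I * (((Real.pi / 4 : ℝ) : ℂ) * (-1 * -1 - -1 - -1)) =
          (Real.pi / 4 : ℝ) * Complex.I - Real.pi * Complex.I by push_cast; ring,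
          Complex.exp_sub, Complex.exp_pi_mul_I, div_neg, div_one, mul_one, sgn_one, mul_neg_one]
    · simp

/-! ### Amplitudes as path sums -/

/-- The yellow sites. -/
abbrev Yellow (m : ℕ) : Type := {v : Site m // IsYellow v}

/-- The blue sites. -/
abbrev Blue (m : ℕ) : Type := {v : Site m // IsBlue v}

/-- The pink sites. -/
abbrev Pink (m : ℕ) : Type := {v : Site m // IsPink v}

/-- Extension by zero of a bit assignment on the yellow sites. -/
def extendYellow {m : ℕ} (y : Yellow m → ZMod 2) (v : Site m) : ZMod 2 :=
  if h : IsYellow v then y ⟨v, h⟩ else 0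

lemma extendYellow_apply {m : ℕ} (y : Yellow m → ZMod 2) (v : Yellow m) :
    extendYellow y v.1 = y v := by
  rw [extendYellow, dif_pos v.2]

lemma nbrSum_add {m : ℕ} (z z' : Site m → ZMod 2) (v : Site m) :
    nbrSum (z + z') v = nbrSum z v + nbrSum z' v := by
  classical
  simp only [nbrSum]
  rw [← Finset.sum_add_distrib]
  refine Finset.sum_congr rfl fun w _ => ?_
  simp only [Pi.add_apply]
  split_ifs <;> ring

lemma extendYellow_add {m : ℕ} (y y' : Yellow m → ZMod 2) :
    extendYellow (y + y') = extendYellow y + extendYellow y' := by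
  funext v
  simp only [extendYellow, Pi.add_apply]
  split_ifs <;> simp

/-- The neighbour sums at the sites of a set, as a homomorphism on the yellow bits. -/
noncomputable def checkHom {m : ℕ} (p : Site m → Prop) :
    (Yellow m → ZMod 2) →+ ({v : Site m // p v} → ZMod 2) :=
  AddMonoidHom.mk' (fun y v => nbrSum (extendYellow y) v.1) fun y y' => by
    funext v
    simp only [extendYellow_add, nbrSum_add, Pi.add_apply]

lemma checkHom_apply {m : ℕ} (p : Site m → Prop) (y : Yellow m → ZMod 2)
    (v : {v : Site m // p v}) : checkHom p y v = nbrSum (extendYellow y) v.1 := rfl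

lemma nbrSum_congr {m : ℕ} {z z' : Site m → ZMod 2} {v : Site m} (hv : ¬ IsYellow v)
    (h : ∀ w, IsYellow w → z w = z' w) : nbrSum z v = nbrSum z' v := by
  classical
  refine Finset.sum_congr rfl fun w _ => ?_
  have h1 : (if IsBond v w then z w else 0) = if IsBond v w then z' w else 0 := by
    split_ifs with hb
    · exact h w (by by_contra hw; exact hv (hb.isYellow_iff_not.2 hw))
    · rfl
  have h2 : (if IsBond w v then z w else 0) = if IsBond w v then z' w else 0 := by
    split_ifs with hb
    · exact h w (hb.isYellow_iff_not.2 hv)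
    · rfl
  rw [h1, h2]

/-- The paths: assignments of bits to the yellow sites with prescribed neighbour sums at the blue
sites. -/
noncomputable def pathSet {m : ℕ} (x : Site m → ZMod 2) : Finset (Yellow m → ZMod 2) :=
  Finset.univ.filter fun y => checkHom IsBlue y = fun v => x v.1

/-- The path sum that belongs to an outcome `x` and a configuration `β`. -/
noncomputable def pathSum {m : ℕ} (x : Site m → ZMod 2)
    (β : (Pink m → ZMod 2) × (Yellow m → Fin 4)) : ℂ :=
  ∑ y ∈ pathSet x, pathTerm (fun v : Yellow m => x v.1) (fun v : Pink m => x v.1)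
    (checkHom IsPink) β y

lemma ketPlus_apply (a : Fin 2) : ketPlus a = ((1 / √2 : ℝ) : ℂ) := by
  fin_cases a <;> simp [ketPlus, ket]

lemma siteState_of_isPink {m : ℕ} (β : Config m) {v : Site m} (h : IsPink v) (a : Fin 2) :
    siteState β v a = if a = β.1 ⟨v, h⟩ then 1 else 0 := by
  rw [siteState, dif_pos h, ket, Pi.single_apply]

lemma siteState_of_isYellow {m : ℕ} (β : Config m) {v : Site m} (h : IsYellow v) (a : Fin 2) :
    siteState β v a = ((1 / √2 : ℝ) : ℂ) * theta (β.2 ⟨v, h⟩) a := by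
  rw [siteState, dif_neg h.1, dif_pos h, pauliZ_eq, ← Matrix.diagonal_smul, Matrix.exp_diagonal,
    Matrix.mulVec_diagonal, ketPlus_apply, Pi.exp_def, mul_comm]
  congr 1
  refine Eq.trans ?_ (theta_eq_exp _ _).symm
  rw [Complex.exp_eq_exp_ℂ]
  rfl

lemma siteState_of_isBlue {m : ℕ} (β : Config m) {v : Site m} (h : IsBlue v) (a : Fin 2) :
    siteState β v a = ((1 / √2 : ℝ) : ℂ) := by
  have hy : ¬ IsYellow v := fun hy => by
    have h1 := hy.2
    have h2 := h.2
    rw [← Nat.not_even_iff_odd] at h2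
    exact h2 h1
  rw [siteState, dif_neg h.1, dif_neg hy, ketPlus_apply]

lemma amplitude_eq_sum_bits {m : ℕ} (x : Bits (Site m)) (β : Config m) :
    amplitude x β = ∑ z : Bits (Site m), (∏ v, hadamard (x v) (z v)) *
      (Complex.exp (-Complex.I * energy (m := m) z) * ∏ v, siteState β v (z v)) := by
  rw [amplitude, exp_hamiltonian, Matrix.mulVec, dotProduct]
  refine Finset.sum_congr rfl fun z _ => ?_
  rw [Matrix.mul_diagonal, tensorOp, Matrix.of_apply, psi, tensorState, mul_assoc]

/-- The pink bits of a configuration, as elements of `ZMod 2`. -/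
def pinkBits {m : ℕ} (β : Config m) : Pink m → ZMod 2 := β.1

/-- The components of the initial state of one qubit, indexed by `ZMod 2`. -/
noncomputable def siteAmp {m : ℕ} (β : Config m) (v : Site m) (a : ZMod 2) : ℂ := siteState β v a

lemma siteAmp_of_isPink {m : ℕ} (β : Config m) {v : Site m} (h : IsPink v) (a : ZMod 2) :
    siteAmp β v a = if a = pinkBits β ⟨v, h⟩ then 1 else 0 := siteState_of_isPink β h a

lemma siteAmp_of_isYellow {m : ℕ} (β : Config m) {v : Site m} (h : IsYellow v) (a : ZMod 2) :
    siteAmp β v a = ((1 / √2 : ℝ) : ℂ) * theta (β.2 ⟨v, h⟩) a := siteState_of_isYellow β h a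

lemma siteAmp_of_isBlue {m : ℕ} (β : Config m) {v : Site m} (h : IsBlue v) (a : ZMod 2) :
    siteAmp β v a = ((1 / √2 : ℝ) : ℂ) := siteState_of_isBlue β h a

lemma amplitude_eq_sum {m : ℕ} (x : Site m → ZMod 2) (β : Config m) :
    amplitude x β = ∑ z : Site m → ZMod 2,
      (((1 / √2 : ℝ) : ℂ) ^ Fintype.card (Site m) * ∏ v, sgn (x v * z v)) *
      (Complex.exp (-Complex.I * energy z) * ∏ v, siteAmp β v (z v)) := by
  refine (amplitude_eq_sum_bits x β).trans (Finset.sum_congr rfl fun z _ => ?_)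
  rw [Finset.prod_congr rfl fun v _ => hadamard_apply (x v) (z v), Finset.prod_mul_distrib,
    Finset.prod_const, Finset.card_univ]
  rfl

lemma isPink_or_isBlue {m : ℕ} (v : Site m) (h : ¬ IsYellow v) : IsPink v ∨ IsBlue v := by
  by_cases hp : IsPink v
  · exact Or.inl hp
  · refine Or.inr ⟨hp, ?_⟩
    rw [← Nat.not_even_iff_odd]
    exact fun he => h ⟨hp, he⟩

lemma IsPink.not_isYellow {m : ℕ} {v : Site m} (h : IsPink v) : ¬ IsYellow v := fun h' => h'.1 h

lemma IsBlue.not_isYellow {m : ℕ} {v : Site m} (h : IsBlue v) : ¬ IsYellow v := fun h' =>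
  Nat.not_even_iff_odd.2 h.2 h'.2

lemma prod_not_isYellow {m : ℕ} (F : Site m → ℂ) :
    ∏ v : {v : Site m // ¬ IsYellow v}, F v.1 = (∏ v : Pink m, F v.1) * ∏ v : Blue m, F v.1 := by
  rw [← Finset.prod_subtype (Finset.univ.filter fun v : Site m => ¬ IsYellow v) (by simp) F,
    ← Finset.prod_subtype (Finset.univ.filter fun v : Site m => IsPink v) (by simp) F,
    ← Finset.prod_subtype (Finset.univ.filter fun v : Site m => IsBlue v) (by simp) F,
    ← Finset.prod_union]
  · congr 1
    ext v
    simp only [Finset.mem_filter, Finset.mem_univ, true_and, Finset.mem_union]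
    exact ⟨isPink_or_isBlue v, fun h => h.elim IsPink.not_isYellow IsBlue.not_isYellow⟩
  · rw [Finset.disjoint_filter]
    exact fun v _ h h' => h'.1 h

lemma sum_zmod_two (f : ZMod 2 → ℂ) : ∑ b, f b = f 0 + f 1 := Fin.sum_univ_two f

/-- Summing over the qubits that are not yellow. -/
lemma prod_sum_not_isYellow {m : ℕ} (x : Site m → ZMod 2) (β : Config m)
    (y : Yellow m → ZMod 2) :
    (∏ v : {v : Site m // ¬ IsYellow v}, ∑ a : ZMod 2,
      sgn (a * nbrSum (extendYellow y) v.1) * (sgn (x v.1 * a) * siteAmp β v.1 a)) =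
    (√2 : ℂ) ^ Fintype.card (Blue m) *
      if y ∈ pathSet x then ∏ v : Pink m, sgn (pinkBits β v * (x v.1 + checkHom IsPink y v)) else 0 := by
  rw [prod_not_isYellow fun v => ∑ a : ZMod 2,
      sgn (a * nbrSum (extendYellow y) v) * (sgn (x v * a) * siteAmp β v a)]
  have hp : ∀ v : Pink m, (∑ a : ZMod 2, sgn (a * nbrSum (extendYellow y) v.1) *
      (sgn (x v.1 * a) * siteAmp β v.1 a)) = sgn (pinkBits β v * (x v.1 + checkHom IsPink y v)) := by
    intro v
    rw [Finset.sum_eq_single (pinkBits β v)]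
    · rw [siteAmp_of_isPink β v.2, if_pos rfl, mul_one, ← sgn_add, checkHom_apply]
      congr 1
      ring
    · intro a _ ha
      rw [siteAmp_of_isPink β v.2, if_neg ha, mul_zero, mul_zero]
    · exact fun h => absurd (Finset.mem_univ _) h
  -- The two values of a blue bit interfere constructively, with total 2/√2 = √2, exactly if the
  -- neighbour sum equals the outcome; otherwise they cancel.
  have hb : ∀ v : Blue m, (∑ a : ZMod 2, sgn (a * nbrSum (extendYellow y) v.1) *
      (sgn (x v.1 * a) * siteAmp β v.1 a)) =
      (√2 : ℂ) * if checkHom IsBlue y v = x v.1 then 1 else 0 := by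
    intro v
    rw [checkHom_apply, sum_zmod_two, siteAmp_of_isBlue β v.2, siteAmp_of_isBlue β v.2]
    have hs : (√2 : ℂ) * √2 = 2 := by
      rw [← Complex.ofReal_mul, Real.mul_self_sqrt (by norm_num)]; norm_num
    have hs0 : (√2 : ℂ) ≠ 0 := by
      intro h; rw [h] at hs; norm_num at hs
    have h2 : (1 / √2 : ℂ) + 1 / √2 = √2 := by
      field_simp
      rw [pow_two, hs]; norm_num
    push_cast
    rcases zmod_two_cases (nbrSum (extendYellow y) v.1) with h | h <;>
      rcases zmod_two_cases (x v.1) with h' | h' <;> rw [h, h'] <;> simp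
    · simpa using h2
    · simpa using h2
  rw [Finset.prod_congr rfl fun v _ => hp v, Finset.prod_congr rfl fun v _ => hb v,
    Finset.prod_mul_distrib, Finset.prod_const, Finset.card_univ]
  have hmem : y ∈ pathSet x ↔ ∀ v : Blue m, checkHom IsBlue y v = x v.1 := by
    simp [pathSet, funext_iff]
  by_cases h : y ∈ pathSet x
  · rw [if_pos h, Finset.prod_congr rfl fun v _ => if_pos (hmem.1 h v)]
    simp
    ring
  · rw [if_neg h]
    rw [hmem] at h
    push Not at h
    obtain ⟨v, hv⟩ := h
    rw [Finset.prod_eq_zero (Finset.mem_univ v) (if_neg hv)]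
    simp

/-- For fixed yellow bits the sum over all other bits factorises over sites, by `bondSum_eq`. The
factors are the blue constraints, which cut the sum down to the paths, and the pink signs. -/
lemma exists_amplitude_eq (m : ℕ) : ∃ γ : ℂ, ‖γ‖ = 1 ∧ ∀ (x : Site m → ZMod 2) (β : Config m),
    amplitude x β = ((1 / √2 : ℝ) : ℂ) ^ Fintype.card (Site m) * γ *
      (((1 / √2 : ℝ) : ℂ) ^ Fintype.card (Yellow m) * (√2 : ℂ) ^ Fintype.card (Blue m)) *
      pathSum x (pinkBits β, β.2) := by
  obtain ⟨γ, hγ, hE⟩ := exists_exp_energy m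
  refine ⟨γ, hγ, fun x β => ?_⟩
  set s : ℂ := ((1 / √2 : ℝ) : ℂ) with hs
  set A : Site m → ZMod 2 → ℂ := fun v a => sgn (x v * a) * siteAmp β v a with hA
  have hterm : ∀ z : Site m → ZMod 2, (s ^ Fintype.card (Site m) * ∏ v, sgn (x v * z v)) *
      (Complex.exp (-Complex.I * energy z) * ∏ v, siteAmp β v (z v)) =
      s ^ Fintype.card (Site m) * γ * ((∏ v : Yellow m, A v.1 (z v.1)) *
        ∏ v : {v : Site m // ¬ IsYellow v},
          (sgn (z v.1 * nbrSum (extendYellow fun w : Yellow m => z w.1) v.1) * A v.1 (z v.1))) := by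
    intro z
    have h2 : sgn (bondSum z) = ∏ v : {v : Site m // ¬ IsYellow v},
        sgn (z v.1 * nbrSum (extendYellow fun w : Yellow m => z w.1) v.1) := by
      rw [bondSum_eq, sgn_sum]
      refine Finset.prod_congr rfl fun v _ => ?_
      rw [nbrSum_congr v.2 (z' := extendYellow fun w : Yellow m => z w.1)]
      intro w hw
      rw [extendYellow, dif_pos hw]
    have h3 : (∏ v, sgn (x v * z v)) * ∏ v, siteAmp β v (z v) =
        (∏ v : Yellow m, A v.1 (z v.1)) * ∏ v : {v : Site m // ¬ IsYellow v}, A v.1 (z v.1) := by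
      rw [← Finset.prod_mul_distrib]
      exact (Fintype.prod_subtype_mul_prod_subtype IsYellow fun v => A v (z v)).symm
    have h4 : (∏ v : {v : Site m // ¬ IsYellow v},
          (sgn (z v.1 * nbrSum (extendYellow fun w : Yellow m => z w.1) v.1) * A v.1 (z v.1))) =
        (∏ v : {v : Site m // ¬ IsYellow v},
          sgn (z v.1 * nbrSum (extendYellow fun w : Yellow m => z w.1) v.1)) *
        ∏ v : {v : Site m // ¬ IsYellow v}, A v.1 (z v.1) := Finset.prod_mul_distrib
    rw [hE, h2, h4]
    linear_combination (s ^ Fintype.card (Site m) * γ *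
      ∏ v : {v : Site m // ¬ IsYellow v},
        sgn (z v.1 * nbrSum (extendYellow fun w : Yellow m => z w.1) v.1)) * h3
  rw [amplitude_eq_sum, Finset.sum_congr rfl fun z _ => hterm z, ← Finset.mul_sum, mul_assoc (_ * γ)]
  congr 1
  refine (Fintype.sum_equiv (Equiv.piEquivPiSubtypeProd IsYellow fun _ => ZMod 2) _
    (fun p : (Yellow m → ZMod 2) × ({v : Site m // ¬ IsYellow v} → ZMod 2) =>
      (∏ v : Yellow m, A v.1 (p.1 v)) * ∏ v : {v : Site m // ¬ IsYellow v},
        (sgn (p.2 v * nbrSum (extendYellow p.1) v.1) * A v.1 (p.2 v))) fun z => rfl).trans ?_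
  rw [Fintype.sum_prod_type, pathSum, ← Finset.sum_filter_add_sum_filter_not Finset.univ (· ∈ pathSet x)]
  have hone : ∀ y : Yellow m → ZMod 2, ∑ o : {v : Site m // ¬ IsYellow v} → ZMod 2,
      ((∏ v : Yellow m, A v.1 (y v)) * ∏ v : {v : Site m // ¬ IsYellow v},
        (sgn (o v * nbrSum (extendYellow y) v.1) * A v.1 (o v))) =
      (s ^ Fintype.card (Yellow m) * (√2 : ℂ) ^ Fintype.card (Blue m)) *
      if y ∈ pathSet x then pathTerm (fun v : Yellow m => x v.1) (fun v : Pink m => x v.1)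
        (checkHom IsPink) (pinkBits β, β.2) y else 0 := by
    intro y
    rw [← Finset.mul_sum, sum_prod_pi fun (v : {v : Site m // ¬ IsYellow v}) (a : ZMod 2) =>
      sgn (a * nbrSum (extendYellow y) v.1) * A v.1 a, prod_sum_not_isYellow]
    have hY : ∏ v : Yellow m, A v.1 (y v) = s ^ Fintype.card (Yellow m) *
        ∏ v : Yellow m, (sgn (x v.1 * y v) * theta (β.2 v) (y v)) := by
      rw [← Finset.card_univ, ← Finset.prod_const, ← Finset.prod_mul_distrib]
      refine Finset.prod_congr rfl fun v _ => ?_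
      simp only [hA]
      rw [siteAmp_of_isYellow β v.2]
      ring
    rw [hY]
    split_ifs
    · rw [pathTerm]; ring
    · ring
  simp only [hone]
  rw [← Finset.mul_sum, ← Finset.mul_sum, ← mul_add,
    Finset.sum_filter_add_sum_filter_not, Finset.sum_ite_mem, Finset.univ_inter]

lemma norm_amplitude_sq {m : ℕ} (x : Site m → ZMod 2) (β : Config m) :
    ‖amplitude x β‖ ^ 2 = 2 ^ Fintype.card (Blue m) /
      (2 ^ Fintype.card (Site m) * 2 ^ Fintype.card (Yellow m)) * ‖pathSum x (pinkBits β, β.2)‖ ^ 2 := by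
  obtain ⟨γ, hγ, h⟩ := exists_amplitude_eq m
  have h2 : (√2 : ℝ) ^ 2 = 2 := Real.sq_sqrt (by norm_num)
  rw [h x β]
  simp only [norm_mul, norm_pow, hγ, Complex.norm_real, mul_pow, Real.norm_eq_abs, ← pow_mul]
  simp only [mul_comm _ 2, pow_mul, sq_abs, div_pow, one_pow, h2]
  field_simp

/-! ### Normalization -/

lemma sum_norm_siteAmp_sq {m : ℕ} (β : Config m) (v : Site m) :
    ∑ a, ‖siteAmp β v a‖ ^ 2 = 1 := by
  have h2 : (√2 : ℝ) ^ 2 = 2 := Real.sq_sqrt (by norm_num)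
  have hs : ‖((1 / √2 : ℝ) : ℂ)‖ ^ 2 = 1 / 2 := by
    rw [Complex.norm_real, Real.norm_eq_abs, sq_abs, div_pow, h2, one_pow]
  by_cases hp : IsPink v
  · simp only [siteAmp_of_isPink β hp]
    rw [Finset.sum_eq_single (pinkBits β ⟨v, hp⟩)]
    · simp
    · intro a _ ha; simp [ha]
    · simp
  by_cases hy : IsYellow v
  · have : ∀ a, ‖siteAmp β v a‖ ^ 2 = 1 / 2 := fun a => by
      rw [siteAmp_of_isYellow β hy, norm_mul, norm_theta, mul_one, hs]
    simp [this]
  · have : ∀ a, ‖siteAmp β v a‖ ^ 2 = 1 / 2 := fun a => by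
      rw [siteAmp_of_isBlue β ((isPink_or_isBlue v hy).resolve_left hp), hs]
    simp [this]

lemma hadamard_mul_hadamard : hadamard * hadamard = 1 := by
  have hs : ((1 / √2 : ℝ) : ℂ) * ((1 / √2 : ℝ) : ℂ) = 1 / 2 := by
    rw [← Complex.ofReal_mul, div_mul_div_comm, Real.mul_self_sqrt (by norm_num)]; norm_num
  rw [hadamard, Matrix.smul_mul, Matrix.mul_smul, smul_smul, hs]
  ext i j
  fin_cases i <;> fin_cases j <;> simp <;> norm_num

lemma tensorOp_hadamard_unitary (V : Type) [Fintype V] [DecidableEq V] :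
    (tensorOp fun _ : V => hadamard)ᴴ * (tensorOp fun _ : V => hadamard) = 1 := by
  have hself : (tensorOp fun _ : V => hadamard)ᴴ = tensorOp fun _ : V => hadamard := by
    ext x z
    rw [Matrix.conjTranspose_apply, tensorOp, Matrix.of_apply, Matrix.of_apply, star_prod]
    refine Finset.prod_congr rfl fun v _ => ?_
    rw [hadamard_apply, hadamard_apply, mul_comm (z v : ZMod 2), star_mul']
    exact congrArg₂ _ (Complex.conj_ofReal _) (conj_sgn _)
  rw [hself]
  ext x z
  rw [Matrix.mul_apply]
  simp only [tensorOp, Matrix.of_apply, ← Finset.prod_mul_distrib]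
  rw [sum_prod_pi fun v a => hadamard (x v) a * hadamard a (z v)]
  have : ∀ v, ∑ a, hadamard (x v) a * hadamard a (z v) = if x v = z v then 1 else 0 := fun v => by
    rw [← Matrix.mul_apply, hadamard_mul_hadamard, Matrix.one_apply]
  simp only [this]
  by_cases h : x = z
  · subst h; simp
  · rw [Matrix.one_apply_ne h]
    obtain ⟨v, hv⟩ := Function.ne_iff.1 h
    exact Finset.prod_eq_zero (Finset.mem_univ v) (if_neg hv)

lemma sum_norm_sq_mulVec {ι : Type*} [Fintype ι] [DecidableEq ι] (U : Matrix ι ι ℂ)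
    (hU : Uᴴ * U = 1) (φ : ι → ℂ) : ∑ i, ‖(U *ᵥ φ) i‖ ^ 2 = ∑ i, ‖φ i‖ ^ 2 := by
  have key : ∀ ψ : ι → ℂ, ((∑ i, ‖ψ i‖ ^ 2 : ℝ) : ℂ) = star ψ ⬝ᵥ ψ := fun ψ => by
    rw [dotProduct, Complex.ofReal_sum]
    refine Finset.sum_congr rfl fun i _ => ?_
    rw [← Complex.normSq_eq_norm_sq, Complex.normSq_eq_conj_mul_self]; rfl
  apply Complex.ofReal_injective
  rw [key, key, Matrix.star_mulVec, Matrix.dotProduct_mulVec, Matrix.vecMul_vecMul, hU,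
    Matrix.vecMul_one]

/-- The Hadamard layer is unitary, the evolution is a diagonal matrix of phases, and the product
state has unit factors. -/
lemma sum_norm_amplitude_sq {m : ℕ} (β : Config m) :
    ∑ x : Bits (Site m), ‖amplitude x β‖ ^ 2 = 1 := by
  have hamp : ∀ x : Bits (Site m), amplitude x β = ((tensorOp fun _ : Site m => hadamard) *ᵥ
      fun z => Complex.exp (-Complex.I * energy (m := m) z) * ∏ v, siteState β v (z v)) x :=
    fun x => amplitude_eq_sum_bits x β
  simp only [hamp]
  rw [sum_norm_sq_mulVec _ (tensorOp_hadamard_unitary _)]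
  obtain ⟨γ, hγ, hE⟩ := exists_exp_energy m
  have h1 : ∀ z : Site m → ZMod 2, ‖Complex.exp (-Complex.I * energy z) *
      ∏ v, siteAmp β v (z v)‖ ^ 2 = ∏ v, ‖siteAmp β v (z v)‖ ^ 2 := fun z => by
    rw [hE, norm_mul, norm_mul, hγ, norm_sgn, one_mul, one_mul, norm_prod, Finset.prod_pow]
  have h2 : ∑ z : Site m → ZMod 2, ∏ v, ‖siteAmp β v (z v)‖ ^ 2 = 1 := by
    have := Finset.prod_univ_sum (fun _ : Site m => (Finset.univ : Finset (ZMod 2)))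
      fun v a => ‖siteAmp β v a‖ ^ 2
    rw [Fintype.piFinset_univ] at this
    rw [← this]
    exact Finset.prod_eq_one fun v _ => sum_norm_siteAmp_sq β v
  exact (Finset.sum_congr rfl fun z _ => h1 z).trans h2

lemma ncard_Sac_pos (m : ℕ) : 0 < (Sac m).ncard :=
  (Set.ncard_pos (Set.finite_range _)).2 (Set.range_nonempty _)

/-- Injectivity of β ↦ ψ_β is not needed: each β has weight 1/|S_ac|, so this inequality suffices
for a lower bound on the probability. -/
lemma ncard_Sac_le (m : ℕ) : (Sac m).ncard ≤ Fintype.card (Config m) := by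
  rw [Sac, ← Set.image_univ, ← Nat.card_eq_fintype_card, ← Set.ncard_univ]
  exact Set.ncard_image_le Set.finite_univ

theorem qMarginal_eq {m : ℕ} (β : Config m) : qMarginal β = 1 / ((Sac m).ncard : ℝ) := by
  simp only [qMarginal, qJoint]
  rw [← Finset.sum_div, sum_norm_amplitude_sq]

lemma qCond_eq {m : ℕ} (x : Bits (Site m)) (β : Config m) :
    qCond x β = ‖amplitude x β‖ ^ 2 := by
  have h : ((Sac m).ncard : ℝ) ≠ 0 := by exact_mod_cast (ncard_Sac_pos m).ne'
  rw [qCond, qMarginal_eq, qJoint]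
  field_simp

/-! ### The lattice in coordinates -/

/-- A bit assignment as a function of the row and column numbers, zero outside the lattice. -/
def grid {m : ℕ} (z : Site m → ZMod 2) (i j : ℕ) : ZMod 2 :=
  ∑ w : Site m, if row w = i ∧ col w = j then z w else 0

lemma site_ext {m : ℕ} {v w : Site m} (h₁ : row v = row w) (h₂ : col v = col w) : v = w := by
  unfold row at h₁
  unfold col at h₂
  exact Prod.ext (Fin.ext (by omega)) (Fin.ext (by omega))

lemma grid_row_col {m : ℕ} (z : Site m → ZMod 2) (v : Site m) : grid z (row v) (col v) = z v := by
  rw [grid, Finset.sum_eq_single v]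
  · simp
  · exact fun w _ hw => if_neg fun h => hw (site_ext h.1 h.2)
  · simp

lemma grid_add {m : ℕ} (z z' : Site m → ZMod 2) : grid (z + z') = grid z + grid z' := by
  funext i j
  simp only [grid, Pi.add_apply, ← Finset.sum_add_distrib]
  refine Finset.sum_congr rfl fun w _ => ?_
  split_ifs <;> simp

lemma row_pos {m : ℕ} (v : Site m) : 1 ≤ row v := Nat.succ_pos _

lemma col_pos {m : ℕ} (v : Site m) : 1 ≤ col v := Nat.succ_pos _

lemma row_le {m : ℕ} (v : Site m) : row v ≤ m := v.1.isLt

lemma col_le {m : ℕ} (v : Site m) : col v ≤ 2 * m + 1 := v.2.isLt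

lemma exists_site {m i j : ℕ} (h₁ : 1 ≤ i) (h₂ : i ≤ m) (h₃ : 1 ≤ j) (h₄ : j ≤ 2 * m + 1) :
    ∃ v : Site m, row v = i ∧ col v = j :=
  ⟨(⟨i - 1, by omega⟩, ⟨j - 1, by omega⟩), by simp only [row]; omega, by simp only [col]; omega⟩

lemma isSupported_grid {m : ℕ} (y : Yellow m → ZMod 2) : IsSupported m (grid (extendYellow y)) := by
  intro i j hij
  refine Finset.sum_eq_zero fun w _ => ?_
  split_ifs with h
  · rw [extendYellow, dif_neg]
    rw [isYellow_iff, h.1, h.2]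
    obtain ⟨rfl, rfl⟩ := h
    exact fun h' => hij ⟨row_pos w, row_le w, col_pos w, col_le w, h'⟩
  · rfl

/-- In columns divisible by 4 there are no pink sites, since these lie in odd columns; there "not
yellow" means blue. -/
lemma delta_of_not_isYellow {m : ℕ} {v : Site m} (hv : ¬ IsYellow v) (w : Site m) :
    delta v w = if row v ≠ row w ∧ col v % 4 = 0 then 0 else 1 := by
  unfold delta
  have h : col v % 4 = 0 → IsBlue v := fun h =>
    (isPink_or_isBlue v hv).resolve_left fun hp => by have := hp.2; omega
  by_cases h1 : row v ≠ row w ∧ col v % 4 = 0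
  · rw [if_pos h1, if_pos ⟨h1.1, h1.2, h h1.2⟩]
  · rw [if_neg h1, if_neg fun h' => h1 ⟨h'.1, h'.2.1⟩, if_neg fun h' => hv h'.2.2]

lemma delta_of_isYellow {m : ℕ} {v : Site m} (hv : IsYellow v) (w : Site m) :
    delta v w = if row v ≠ row w ∧ col v % 4 = 2 then 0 else 1 := by
  unfold delta
  rw [if_neg fun h => h.2.2.not_isYellow hv]
  by_cases h1 : row v ≠ row w ∧ col v % 4 = 2
  · rw [if_pos h1, if_pos ⟨h1.1, h1.2, hv⟩]
  · rw [if_neg h1, if_neg fun h' => h1 ⟨h'.1, h'.2.1⟩]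

lemma isBond_from_iff {m : ℕ} {v : Site m} (hv : ¬ IsYellow v) (w : Site m) :
    IsBond v w ↔ (row w = row v ∧ col w = col v + 1) ∨
      (row w = row v + 1 ∧ col w = col v ∧ ¬ col v % 4 = 0) := by
  rw [IsBond, isDirectedEdge_iff, delta_of_not_isYellow hv]
  split_ifs with h
  · simp only [zero_ne_one, and_false, false_iff]
    omega
  · simp only [and_true]
    omega

lemma isBond_to_iff {m : ℕ} {v : Site m} (hv : ¬ IsYellow v) (w : Site m) :
    IsBond w v ↔ (row w = row v ∧ col w = col v - 1) ∨
      (row w = row v - 1 ∧ col w = col v ∧ ¬ col v % 4 = 2) := by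
  have := row_pos v
  have := row_pos w
  have := col_pos v
  have := col_pos w
  rw [isYellow_iff] at hv
  by_cases hw : IsYellow w
  · rw [IsBond, isDirectedEdge_iff, delta_of_isYellow hw]
    split_ifs with h
    · simp only [zero_ne_one, and_false, false_iff]
      omega
    · simp only [and_true]
      omega
  · refine ⟨fun h => absurd (h.isYellow_iff_not.2 (by rwa [isYellow_iff])) hw, fun h => ?_⟩
    rw [isYellow_iff] at hw
    omega

/-- The coefficient of a vertical edge is decided by its upper end. For v this is v itself on the
edge downwards (cut in columns 0 mod 4) and a yellow site on the edge upwards (cut in columns 2 mod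
4). -/
lemma nbrSum_eq_stencil {m : ℕ} (z : Site m → ZMod 2) {v : Site m} (hv : ¬ IsYellow v) :
    nbrSum z v = stencil (grid z) (row v) (col v) := by
  have e1 : (if col v % 4 = 2 then 0 else grid z (row v - 1) (col v)) =
      ∑ w, if row w = row v - 1 ∧ col w = col v ∧ ¬ col v % 4 = 2 then z w else 0 := by
    split_ifs with h <;> simp [grid, h]
  have e2 : (if col v % 4 = 0 then 0 else grid z (row v + 1) (col v)) =
      ∑ w, if row w = row v + 1 ∧ col w = col v ∧ ¬ col v % 4 = 0 then z w else 0 := by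
    split_ifs with h <;> simp [grid, h]
  rw [stencil, e1, e2, grid, grid, ← Finset.sum_add_distrib, ← Finset.sum_add_distrib,
    ← Finset.sum_add_distrib, nbrSum]
  refine Finset.sum_congr rfl fun w _ => ?_
  have or_split : ∀ (p q : Prop) [Decidable p] [Decidable q] [Decidable (p ∨ q)], ¬ (p ∧ q) →
      (if p ∨ q then z w else 0) = (if p then z w else 0) + if q then z w else 0 := by
    intro p q _ _ _ hpq
    by_cases hp : p
    · have hq : ¬ q := fun hq => hpq ⟨hp, hq⟩
      simp [hp, hq]
    · simp [hp]
  have hr := row_pos v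
  have hc := col_pos v
  simp only [isBond_from_iff hv w, isBond_to_iff hv w]
  rw [or_split _ _ (by omega), or_split _ _ (by omega)]
  ring

lemma isBlue_of_inner {m : ℕ} {v : Site m} (h₁ : 2 ≤ col v) (h₂ : col v ≤ 2 * m)
    (h₃ : (row v + col v) % 2 = 1) : IsBlue v := by
  refine ⟨fun hp => ?_, Nat.odd_iff.2 h₃⟩
  have := hp.2
  omega

lemma IsBlue.inner {m : ℕ} {v : Site m} (h : IsBlue v) :
    2 ≤ col v ∧ col v ≤ 2 * m ∧ (row v + col v) % 2 = 1 := by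
  have h1 := h.1
  have h2 := Nat.odd_iff.1 h.2
  have := col_pos v
  have := col_le v
  rw [IsPink, Nat.even_iff] at h1
  omega

lemma isParityFree_grid {m : ℕ} {y : Yellow m → ZMod 2} (h : checkHom IsBlue y = 0) :
    IsParityFree m (grid (extendYellow y)) := by
  intro i j h1 h2 h3 h4 h5
  obtain ⟨v, rfl, rfl⟩ := exists_site h1 h2 (by omega) (by omega : j ≤ 2 * m + 1)
  have hb := isBlue_of_inner h3 h4 h5
  rw [← nbrSum_eq_stencil _ hb.not_isYellow]
  exact congrFun h ⟨v, hb⟩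

lemma yellow_eq_grid {m : ℕ} (y : Yellow m → ZMod 2) (v : Yellow m) :
    y v = grid (extendYellow y) (row v.1) (col v.1) := by
  rw [grid_row_col, extendYellow_apply]

lemma eq_of_grid_eq {m : ℕ} {y y' : Yellow m → ZMod 2}
    (h : grid (extendYellow y) = grid (extendYellow y')) : y = y' := by
  funext v
  rw [yellow_eq_grid y, yellow_eq_grid y', h]

lemma grid_extendYellow_zero (m : ℕ) : grid (extendYellow (0 : Yellow m → ZMod 2)) = 0 := by
  funext i j
  refine Finset.sum_eq_zero fun w _ => ?_
  simp [extendYellow]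

/-! ### Differences of paths and the number of paths -/

lemma mem_pathSet {m : ℕ} {x : Site m → ZMod 2} {y : Yellow m → ZMod 2} :
    y ∈ pathSet x ↔ checkHom IsBlue y = fun v => x v.1 := by
  simp [pathSet]

lemma checkHom_add_eq_zero {m : ℕ} {x : Site m → ZMod 2} {y y' : Yellow m → ZMod 2}
    (h : y ∈ pathSet x) (h' : y' ∈ pathSet x) : checkHom IsBlue (y + y') = 0 := by
  rw [map_add, mem_pathSet.1 h, mem_pathSet.1 h', pi_add_self]

lemma eq_of_add_eq_zero_pi {ι : Type*} {a b : ι → ZMod 2} (h : a + b = 0) : a = b := by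
  funext i
  exact (zmod_two_eq_of_add_eq_zero (congrFun h i)).symm

/-- Differences of paths lie in the kernel of the blue checks, and by hypothesis z₁ + z₃ vanishes
wherever z₁ + z₂ does. -/
theorem pathSet_separating {m : ℕ} {x : Site m → ZMod 2} {z₁ z₂ z₃ : Yellow m → ZMod 2}
    (h₁ : z₁ ∈ pathSet x) (h₂ : z₂ ∈ pathSet x) (h₃ : z₃ ∈ pathSet x)
    (h : ∀ v, z₁ v = z₂ v → z₁ v = z₃ v) : z₁ = z₃ ∨ z₂ = z₃ := by
  have hv : ∀ i j, grid (extendYellow (z₁ + z₂)) i j = 0 →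
      grid (extendYellow (z₁ + z₃)) i j = 0 := by
    intro i j h0
    by_cases hin : 1 ≤ i ∧ i ≤ m ∧ 1 ≤ j ∧ j ≤ 2 * m + 1 ∧ (i + j) % 2 = 0
    swap
    · exact isSupported_grid _ i j hin
    obtain ⟨v, rfl, rfl⟩ := exists_site hin.1 hin.2.1 hin.2.2.1 hin.2.2.2.1
    have hy : IsYellow v := (isYellow_iff v).2 hin.2.2.2.2
    rw [← yellow_eq_grid _ ⟨v, hy⟩] at h0 ⊢
    have := h ⟨v, hy⟩ (zmod_two_eq_of_add_eq_zero h0).symm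
    rw [Pi.add_apply, ← this, CharTwo.add_self_eq_zero]
  rcases eq_zero_or_eq_of_vanish m (grid (extendYellow (z₁ + z₂))) (grid (extendYellow (z₁ + z₃)))
    (isSupported_grid _) (isParityFree_grid (checkHom_add_eq_zero h₁ h₂)) (isSupported_grid _)
    (isParityFree_grid (checkHom_add_eq_zero h₁ h₃)) hv with h0 | h0
  · left
    rw [← grid_extendYellow_zero m] at h0
    exact eq_of_add_eq_zero_pi (eq_of_grid_eq h0)
  · right
    exact (add_left_cancel (eq_of_grid_eq h0)).symm

/-- The path difference that is invisible to the pink sites when `m` is odd. -/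
def oddRowsYellow (m : ℕ) (v : Yellow m) : ZMod 2 := oddRows m (row v.1) (col v.1)

theorem eq_zero_or_eq_oddRowsYellow {m : ℕ} {u : Yellow m → ZMod 2} (hb : checkHom IsBlue u = 0)
    (hp : checkHom IsPink u = 0) : u = 0 ∨ (m % 2 = 1 ∧ u = oddRowsYellow m) := by
  have pink : ∀ e j, 1 ≤ e → e ≤ m → e % 2 = 0 → (j = 1 ∨ j = 2 * m + 1) →
      stencil (grid (extendYellow u)) e j = 0 := by
    intro e j h1 h2 h3 h4
    obtain ⟨v, rfl, rfl⟩ := exists_site h1 h2 (by omega) (by omega : j ≤ 2 * m + 1)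
    have hv : IsPink v := ⟨Nat.even_iff.2 h3, h4⟩
    rw [← nbrSum_eq_stencil _ hv.not_isYellow]
    exact congrFun hp ⟨v, hv⟩
  rcases eq_zero_or_eq_oddRows m (grid (extendYellow u)) (isSupported_grid _)
    (isParityFree_grid hb) (fun e h1 h2 h3 => pink e 1 h1 h2 h3 (Or.inl rfl))
    (fun e h1 h2 h3 => pink e _ h1 h2 h3 (Or.inr rfl)) with h | ⟨hm, h⟩
  · left
    rw [← grid_extendYellow_zero m] at h
    exact eq_of_grid_eq h
  · right
    refine ⟨hm, ?_⟩
    funext v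
    rw [yellow_eq_grid u v, h, oddRowsYellow]

/-- Rows 1 and 3 alone contribute m + 1 sites each, in the odd columns. -/
lemma le_card_oddRowsYellow {m : ℕ} (hm : 3 ≤ m) :
    2 * (m + 1) ≤ (Finset.univ.filter fun v => oddRowsYellow m v ≠ 0).card := by
  have hsite : ∀ p : Fin 2 × Fin (m + 1), ∃ v : Yellow m,
      row v.1 = 2 * p.1.val + 1 ∧ col v.1 = 2 * p.2.val + 1 := by
    rintro ⟨a, t⟩
    obtain ⟨v, h1, h2⟩ := exists_site (m := m) (i := 2 * a.val + 1) (j := 2 * t.val + 1)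
      (by omega) (by omega) (by omega) (by omega)
    exact ⟨⟨v, (isYellow_iff v).2 (by omega)⟩, h1, h2⟩
  choose s hs1 hs2 using hsite
  have hinj : Function.Injective s := by
    intro p q hpq
    have h1 := hs1 p
    have h2 := hs2 p
    rw [hpq, hs1 q] at h1
    rw [hpq, hs2 q] at h2
    exact Prod.ext (Fin.ext (by omega)) (Fin.ext (by omega))
  calc 2 * (m + 1) = (Finset.univ.image s).card := by
        rw [Finset.card_image_of_injective _ hinj]; simp
    _ ≤ _ := by
        refine Finset.card_le_card fun v hv => ?_
        obtain ⟨p, -, rfl⟩ := Finset.mem_image.1 hv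
        rw [Finset.mem_filter]
        refine ⟨Finset.mem_univ _, ?_⟩
        have h1 := hs1 p
        have h2 := hs2 p
        rw [oddRowsYellow, oddRows, if_pos ⟨row_pos _, row_le _, col_pos _, col_le _, by omega,
          by omega⟩]
        exact one_ne_zero

theorem card_pathSet_le {m : ℕ} (x : Site m → ZMod 2) : (pathSet x).card ≤ 2 ^ m := by
  have : (Finset.univ : Finset (Fin m → ZMod 2)).card = 2 ^ m := by simp
  rw [← this]
  refine Finset.card_le_card_of_injOn (fun y i => grid (extendYellow y) (i.val + 1)
    (if i.val % 2 = 0 then 1 else 2)) (fun _ _ => Finset.mem_coe.2 (Finset.mem_univ _)) ?_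
  intro y hy y' hy' h
  refine eq_of_add_eq_zero_pi (eq_of_grid_eq ?_)
  rw [grid_extendYellow_zero]
  have hcol : ∀ i, 1 ≤ i → i ≤ m →
      grid (extendYellow (y + y')) i (if (i - 1) % 2 = 0 then 1 else 2) = 0 := by
    intro i h1 h2
    have := congrFun h ⟨i - 1, by omega⟩
    simp only [Nat.sub_add_cancel h1] at this
    rw [extendYellow_add, grid_add, Pi.add_apply, Pi.add_apply, this,
      CharTwo.add_self_eq_zero]
  refine eq_zero_of_first_columns m _ (isSupported_grid _)
    (isParityFree_grid (checkHom_add_eq_zero hy hy')) ?_ ?_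
  · intro i hi
    by_cases hin : 1 ≤ i ∧ i ≤ m
    · have := hcol i hin.1 hin.2
      rwa [if_pos (by omega)] at this
    · exact isSupported_grid _ i 1 fun h => hin ⟨h.1, h.2.1⟩
  · intro i hi
    by_cases hin : 1 ≤ i ∧ i ≤ m
    · have := hcol i hin.1 hin.2
      rwa [if_neg (by omega)] at this
    · exact isSupported_grid _ i 2 fun h => hin ⟨h.1, h.2.1⟩

/-- A solution of the parity checks with right-hand side `X`, column by column. -/
def solveColumns (m : ℕ) (X : ℕ → ℕ → ZMod 2) : ℕ → ℕ → ZMod 2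
  | 0 => fun _ => 0
  | 1 => fun _ => 0
  | j + 2 => fun i => if 1 ≤ i ∧ i ≤ m ∧ j + 2 ≤ 2 * m + 1 ∧ (i + j) % 2 = 0 then
      solveColumns m X j i + (if (j + 1) % 4 = 2 then 0 else solveColumns m X (j + 1) (i - 1)) +
        (if (j + 1) % 4 = 0 then 0 else solveColumns m X (j + 1) (i + 1)) + X i (j + 1)
    else 0

lemma solveColumns_add_two (m : ℕ) (X : ℕ → ℕ → ZMod 2) (i j : ℕ) :
    solveColumns m X (j + 2) i = if 1 ≤ i ∧ i ≤ m ∧ j + 2 ≤ 2 * m + 1 ∧ (i + j) % 2 = 0 then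
      solveColumns m X j i + (if (j + 1) % 4 = 2 then 0 else solveColumns m X (j + 1) (i - 1)) +
        (if (j + 1) % 4 = 0 then 0 else solveColumns m X (j + 1) (i + 1)) + X i (j + 1)
    else 0 := by
  rw [solveColumns]

/-- No blue site lies in the first or last column, so the check at a blue site can always be solved
for the yellow site to its right, column by column. -/
theorem checkHom_isBlue_surjective (m : ℕ) :
    Function.Surjective (checkHom (m := m) IsBlue) := by
  intro b
  set X : ℕ → ℕ → ZMod 2 := grid fun v => if h : IsBlue v then b ⟨v, h⟩ else 0 with hX
  set y : Yellow m → ZMod 2 := fun v => solveColumns m X (col v.1) (row v.1) with hy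
  have hsupp : IsSupported m fun i j => solveColumns m X j i := by
    intro i j hij
    match j with
    | 0 => rfl
    | 1 => rfl
    | j + 2 =>
      show solveColumns m X (j + 2) i = 0
      rw [solveColumns_add_two, if_neg]
      exact fun h => hij ⟨h.1, h.2.1, by omega, h.2.2.1, by omega⟩
  have hgrid : grid (extendYellow y) = fun i j => solveColumns m X j i := by
    funext i j
    by_cases hin : 1 ≤ i ∧ i ≤ m ∧ 1 ≤ j ∧ j ≤ 2 * m + 1 ∧ (i + j) % 2 = 0
    · obtain ⟨v, rfl, rfl⟩ := exists_site hin.1 hin.2.1 hin.2.2.1 hin.2.2.2.1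
      rw [← yellow_eq_grid y ⟨v, (isYellow_iff v).2 hin.2.2.2.2⟩]
    · rw [isSupported_grid _ i j hin]
      exact (hsupp i j hin).symm
  refine ⟨y, ?_⟩
  funext v
  obtain ⟨h1, h2, h3⟩ := v.2.inner
  rw [checkHom_apply, nbrSum_eq_stencil _ v.2.not_isYellow, hgrid]
  obtain ⟨j, hj⟩ : ∃ j, col v.1 = j + 1 := ⟨col v.1 - 1, by omega⟩
  have hb : X (row v.1) (j + 1) = b v := by
    rw [← hj, hX, grid_row_col, dif_pos v.2]
  have hsol : solveColumns m X (j + 2) (row v.1) = solveColumns m X j (row v.1) +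
      (if (j + 1) % 4 = 2 then 0 else solveColumns m X (j + 1) (row v.1 - 1)) +
        (if (j + 1) % 4 = 0 then 0 else solveColumns m X (j + 1) (row v.1 + 1)) + b v := by
    rw [solveColumns_add_two, if_pos ⟨row_pos _, row_le _, by omega, by omega⟩, hb]
  rw [stencil, hj, Nat.add_sub_cancel, show j + 1 + 1 = j + 2 from rfl, hsol]
  generalize solveColumns m X j (row v.1) = a₁
  generalize (if (j + 1) % 4 = 2 then 0 else solveColumns m X (j + 1) (row v.1 - 1)) = a₂
  generalize (if (j + 1) % 4 = 0 then 0 else solveColumns m X (j + 1) (row v.1 + 1)) = a₃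
  generalize b v = a₄
  revert a₁ a₂ a₃ a₄
  decide

theorem card_pathSet {m : ℕ} (x : Site m → ZMod 2) :
    2 ^ Fintype.card (Yellow m) = 2 ^ Fintype.card (Blue m) * (pathSet x).card := by
  have h := Finset.card_eq_sum_card_fiberwise (f := checkHom (m := m) IsBlue)
    (s := Finset.univ) (t := Finset.univ) fun _ _ => Finset.mem_coe.2 (Finset.mem_univ _)
  have hc : ∀ b ∈ (Finset.univ : Finset (Blue m → ZMod 2)),
      (Finset.univ.filter fun y => checkHom IsBlue y = b).card = (pathSet x).card := fun b _ =>
    AddMonoidHom.card_fiber_eq_of_mem_range (checkHom (m := m) IsBlue)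
      (checkHom_isBlue_surjective m b) (checkHom_isBlue_surjective m fun v => x v.1)
  rw [Finset.sum_congr rfl hc] at h
  simpa using h

lemma pathSet_nonempty {m : ℕ} (x : Site m → ZMod 2) : (pathSet x).Nonempty := by
  obtain ⟨y, hy⟩ := checkHom_isBlue_surjective m fun v => x v.1
  exact ⟨y, mem_pathSet.2 hy⟩

/-! ### Two paths -/

section TwoPaths

variable {Y P : Type} [Fintype Y] [DecidableEq Y] [Fintype P] [DecidableEq P]

lemma exists_pathTerm_update (xY : Y → ZMod 2) (c : P → ZMod 2)
    (N : (Y → ZMod 2) →+ (P → ZMod 2)) (β : (P → ZMod 2) × (Y → Fin 4)) (y₀ : Y)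
    (z : Y → ZMod 2) : ∃ A : ℂ, ‖A‖ = 1 ∧ ∀ k,
      pathTerm xY c N (β.1, Function.update β.2 y₀ k) z = A * theta k (z y₀) := by
  refine ⟨(∏ p, sgn (β.1 p * (c p + N z p))) * (sgn (xY y₀ * z y₀) *
    ∏ y ∈ Finset.univ.erase y₀, (sgn (xY y * z y) * theta (β.2 y) (z y))), ?_, fun k => ?_⟩
  · simp [norm_prod]
  · rw [pathTerm, ← Finset.mul_prod_erase _ _ (Finset.mem_univ y₀)]
    simp only [Function.update_self]
    have h : ∏ y ∈ Finset.univ.erase y₀,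
        (sgn (xY y * z y) * theta (Function.update β.2 y₀ k y) (z y)) =
        ∏ y ∈ Finset.univ.erase y₀, (sgn (xY y * z y) * theta (β.2 y) (z y)) :=
      Finset.prod_congr rfl fun y hy => by
        rw [Function.update_of_ne (Finset.ne_of_mem_erase hy)]
    rw [h]
    ring

/-- |A + B|² < 1 means that the relative angle lies in an open arc of length 2π/3 around π. A
rotation by ±3π/4 moves every point of this arc out of it. -/
lemma norm_add_sq_ge_of_rotation (A B q : ℂ) (hA : ‖A‖ = 1) (hB : ‖B‖ = 1) (hq : q.re = -(√2 / 2))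
    (hq' : q.im ^ 2 = 1 / 2) : 1 ≤ ‖A + B‖ ^ 2 ∨ 1 ≤ ‖A * q + B‖ ^ 2 := by
  have hs : (√2 : ℝ) ^ 2 = 2 := Real.sq_sqrt (by norm_num)
  have hs0 : (0 : ℝ) ≤ √2 := Real.sqrt_nonneg 2
  have nA : A.re * A.re + A.im * A.im = 1 := by
    rw [← Complex.normSq_apply, Complex.normSq_eq_norm_sq, hA, one_pow]
  have nB : B.re * B.re + B.im * B.im = 1 := by
    rw [← Complex.normSq_apply, Complex.normSq_eq_norm_sq, hB, one_pow]
  obtain ⟨p, hp⟩ : ∃ p, p = A.re * B.re + A.im * B.im := ⟨_, rfl⟩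
  obtain ⟨r, hr⟩ : ∃ r, r = A.im * B.re - A.re * B.im := ⟨_, rfl⟩
  have hpr : p ^ 2 + r ^ 2 = 1 := by
    rw [hp, hr]
    linear_combination (B.re * B.re + B.im * B.im) * nA + nB
  have e1 : ‖A + B‖ ^ 2 = 2 + 2 * p := by
    rw [← Complex.normSq_eq_norm_sq, Complex.normSq_apply, Complex.add_re, Complex.add_im, hp]
    linear_combination nA + nB
  have e2 : ‖A * q + B‖ ^ 2 = 2 + 2 * (p * q.re - r * q.im) := by
    rw [← Complex.normSq_eq_norm_sq, Complex.normSq_apply, Complex.add_re, Complex.add_im,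
      Complex.mul_re, Complex.mul_im, hp, hr]
    have : q.re * q.re + q.im * q.im = 1 := by rw [hq]; nlinarith
    linear_combination nB + nA + (A.re * A.re + A.im * A.im) * this
  rw [e1, e2, hq]
  by_contra! h
  obtain ⟨h1, h2⟩ := h
  have hri : (r * q.im) ^ 2 ≤ 1 / 2 := by
    rw [mul_pow, hq']; nlinarith [sq_nonneg p]
  have hp2 : p < -1 / 2 := by linarith
  have h3 : 1 / 2 + √2 / 4 < r * q.im := by nlinarith
  have h4 : (1 / 2 + √2 / 4) ^ 2 < (r * q.im) ^ 2 := pow_lt_pow_left₀ h3 (by positivity) (by norm_num)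
  nlinarith

lemma eighth_pow_six (a : ZMod 2) :
    (eighth a ^ 6).re = -(√2 / 2) ∧ (eighth a ^ 6).im ^ 2 = 1 / 2 := by
  have hs : (√2 : ℝ) ^ 2 = 2 := Real.sq_sqrt (by norm_num)
  have hc : Real.cos (3 * Real.pi / 4) = -(√2 / 2) := by
    rw [show 3 * Real.pi / 4 = Real.pi - Real.pi / 4 by ring, Real.cos_pi_sub, Real.cos_pi_div_four]
  have hsin : Real.sin (3 * Real.pi / 4) = √2 / 2 := by
    rw [show 3 * Real.pi / 4 = Real.pi - Real.pi / 4 by ring, Real.sin_pi_sub, Real.sin_pi_div_four]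
  have key : ∀ x : ℝ, x = 3 * Real.pi / 4 ∨ x = -(3 * Real.pi / 4) →
      (Complex.exp (x * Complex.I)).re = -(√2 / 2) ∧
      (Complex.exp (x * Complex.I)).im ^ 2 = 1 / 2 := by
    intro x hx
    rw [Complex.exp_ofReal_mul_I_re, Complex.exp_ofReal_mul_I_im]
    rcases hx with rfl | rfl
    · rw [hc, hsin, div_pow, hs]; norm_num
    · rw [Real.cos_neg, Real.sin_neg, hc, hsin, neg_sq, div_pow, hs]; norm_num
  have he : eighth a ^ 6 = Complex.exp
      (((if a = 0 then -(3 * Real.pi / 4) else 3 * Real.pi / 4 : ℝ) : ℂ) * Complex.I) := by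
    rw [eighth, ← Complex.exp_nat_mul]
    congr 1
    split_ifs <;> push_cast <;> ring
  rw [he]
  exact key _ (by split_ifs <;> simp)

/-- Anticoncentration of a sum of two paths that differ at the site `y₀`. -/
theorem pathSum_anticoncentration_two (xY : Y → ZMod 2) (c : P → ZMod 2)
    (N : (Y → ZMod 2) →+ (P → ZMod 2)) (C : Finset (Y → ZMod 2)) (hC : C.card = 2) (y₀ : Y)
    (hy₀ : ∀ z ∈ C, ∀ z' ∈ C, z ≠ z' → z y₀ ≠ z' y₀) :
    (Fintype.card ((P → ZMod 2) × (Y → Fin 4)) : ℝ) / 12 ≤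
      ((Finset.univ.filter fun β => (C.card : ℝ) / 2 ≤
        ‖∑ z ∈ C, pathTerm xY c N β z‖ ^ 2).card : ℝ) := by
  classical
  obtain ⟨z, z', hzz, rfl⟩ := Finset.card_eq_two.1 hC
  have hne := hy₀ z (by simp) z' (by simp) hzz
  set G := Finset.univ.filter fun β : (P → ZMod 2) × (Y → Fin 4) =>
    ((({z, z'} : Finset (Y → ZMod 2)).card : ℝ)) / 2 ≤
      ‖∑ w ∈ ({z, z'} : Finset (Y → ZMod 2)), pathTerm xY c N β w‖ ^ 2 with hG
  have hmem : ∀ β, β ∈ G ↔ 1 ≤ ‖pathTerm xY c N β z + pathTerm xY c N β z'‖ ^ 2 := fun β => by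
    rw [hG, Finset.mem_filter, hC, Finset.sum_pair hzz]
    simp
  set up : Fin 4 → (P → ZMod 2) × (Y → Fin 4) → (P → ZMod 2) × (Y → Fin 4) :=
    fun k β => (β.1, Function.update β.2 y₀ k) with hup
  -- Changing k from 0 to 3 at the site where the paths differ turns their relative phase by ±3π/4.
  -- Hence of the four values of k at least one is good, up to the 4-to-1 count below applied twice:
  -- the good fraction is at least 1/8.
  have hgood : ∀ β, up 0 β ∈ G ∨ up 3 β ∈ G := by
    intro β
    obtain ⟨A, hA, hA'⟩ := exists_pathTerm_update xY c N β y₀ z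
    obtain ⟨B, hB, hB'⟩ := exists_pathTerm_update xY c N β y₀ z'
    rw [hmem, hmem]
    simp only [hup, hA', hB']
    have hz' : z' y₀ = z y₀ + 1 := by
      revert hne
      generalize z y₀ = a
      generalize z' y₀ = b
      revert a b; decide
    have h0 : ∀ a, theta 0 a = 1 := fun a => by simp [theta]
    have h3 : ‖A * theta 3 (z y₀) + B * theta 3 (z' y₀)‖ = ‖A * eighth (z y₀) ^ 6 + B‖ := by
      have hu : eighth (z y₀) * eighth (z y₀ + 1) = 1 := by
        rw [eighth_mul, if_neg]
        generalize z y₀ = a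
        revert a; decide
      rw [← mul_one ‖A * theta 3 (z y₀) + B * theta 3 (z' y₀)‖,
        ← norm_theta 3 (z y₀), ← norm_mul, hz']
      congr 1
      have h3v : ((3 : Fin 4).val) = 3 := rfl
      rw [theta, theta, h3v]
      have : (eighth (z y₀) * eighth (z y₀ + 1)) ^ 3 = 1 := by rw [hu, one_pow]
      linear_combination B * this
    rw [h0, h0, mul_one, mul_one, h3]
    exact norm_add_sq_ge_of_rotation A B _ hA hB (eighth_pow_six _).1 (eighth_pow_six _).2
  have hfib : ∀ k, (Finset.univ.filter fun β => up k β ∈ G).card ≤ G.card * 4 := by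
    intro k
    calc _ ≤ (G ×ˢ (Finset.univ : Finset (Fin 4))).card := by
          refine Finset.card_le_card_of_injOn (fun β => (up k β, β.2 y₀)) ?_ ?_
          · intro β hβ
            exact Finset.mem_coe.2 (Finset.mem_product.2 ⟨(Finset.mem_filter.1 hβ).2,
              Finset.mem_univ _⟩)
          · intro β _ β' _ h
            have h1 := congrArg (fun q => q.1.1) h
            have h2 := congrArg (fun q => q.1.2) h
            have h3 := congrArg (fun q => q.2) h
            simp only [hup] at h1 h2 h3
            refine Prod.ext h1 (funext fun y => ?_)
            by_cases hy : y = y₀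
            · rw [hy, h3]
            · have := congrFun h2 y
              rwa [Function.update_of_ne hy, Function.update_of_ne hy] at this
      _ = G.card * 4 := by rw [Finset.card_product]; simp
  have hall : Fintype.card ((P → ZMod 2) × (Y → Fin 4)) ≤ G.card * 4 + G.card * 4 := by
    calc _ = (Finset.univ : Finset ((P → ZMod 2) × (Y → Fin 4))).card := rfl
      _ ≤ ((Finset.univ.filter fun β => up 0 β ∈ G) ∪
          (Finset.univ.filter fun β => up 3 β ∈ G)).card := by
          refine Finset.card_le_card fun β _ => ?_
          exact Finset.mem_union.2 ((hgood β).imp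
            (fun h => Finset.mem_filter.2 ⟨Finset.mem_univ _, h⟩)
            fun h => Finset.mem_filter.2 ⟨Finset.mem_univ _, h⟩)
      _ ≤ _ := (Finset.card_union_le _ _).trans (add_le_add (hfib 0) (hfib 3))
  have hall' : (Fintype.card ((P → ZMod 2) × (Y → Fin 4)) : ℝ) ≤ G.card * 4 + G.card * 4 := by
    exact_mod_cast hall
  have : (0 : ℝ) ≤ G.card := Nat.cast_nonneg _
  linarith

end TwoPaths

/-! ### Anticoncentration of the output distribution -/

theorem pathSet_sum_four {m : ℕ} {x : Site m → ZMod 2} {z₁ z₂ z₃ z₄ : Yellow m → ZMod 2}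
    (h₁ : z₁ ∈ pathSet x) (h₂ : z₂ ∈ pathSet x) (h₃ : z₃ ∈ pathSet x) (h₄ : z₄ ∈ pathSet x)
    (h : checkHom IsPink (z₁ + z₂ + z₃ + z₄) = 0) :
    z₁ + z₂ + z₃ + z₄ = 0 ∨ (m % 2 = 1 ∧ z₁ + z₂ + z₃ + z₄ = oddRowsYellow m) := by
  refine eq_zero_or_eq_oddRowsYellow ?_ h
  rw [add_assoc, map_add, checkHom_add_eq_zero h₁ h₂, checkHom_add_eq_zero h₃ h₄, add_zero]

lemma card_yellow_one : Fintype.card (Yellow 1) = 2 := by decide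

lemma card_blue_one : Fintype.card (Blue 1) = 1 := by decide

theorem pathSum_large {m : ℕ} (x : Site m → ZMod 2) :
    (Fintype.card ((Pink m → ZMod 2) × (Yellow m → Fin 4)) : ℝ) / 12 ≤
      ((Finset.univ.filter fun β => ((pathSet x).card : ℝ) / 2 ≤ ‖pathSum x β‖ ^ 2).card : ℝ) := by
  have hsep := fun z₁ (h₁ : z₁ ∈ pathSet x) z₂ (h₂ : z₂ ∈ pathSet x) z₃ (h₃ : z₃ ∈ pathSet x) =>
    pathSet_separating h₁ h₂ h₃
  rcases Nat.mod_two_eq_zero_or_one m with hm | hm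
  · refine pathSum_anticoncentration _ _ _ (pathSet x) (pathSet_nonempty x) 0 0 le_rfl (by norm_num)
      (by norm_num) hsep ?_
    intro z₁ h₁ z₂ h₂ z₃ h₃ z₄ h₄ h
    exact Or.inl ((pathSet_sum_four h₁ h₂ h₃ h₄ h).resolve_right fun h' => by omega)
  rcases Nat.lt_or_ge m 3 with h3 | h3
  · obtain rfl : m = 1 := by omega
    have hC : (pathSet x).card = 2 := by
      have := card_pathSet x
      rw [card_yellow_one, card_blue_one] at this
      omega
    obtain ⟨v, hv1, hv2⟩ := exists_site (m := 1) (i := 1) (j := 1) le_rfl le_rfl le_rfl (by norm_num)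
    have hvy : IsYellow v := (isYellow_iff v).2 (by omega)
    refine pathSum_anticoncentration_two _ _ _ (pathSet x) hC ⟨v, hvy⟩ ?_
    intro z hz z' hz' hne heq
    have hpink : checkHom IsPink (z + z') = 0 := by
      funext p
      have := p.2.1
      have h1 := row_le p.1
      have h2 := row_pos p.1
      rw [Nat.even_iff] at this
      omega
    rcases eq_zero_or_eq_oddRowsYellow (checkHom_add_eq_zero hz hz') hpink with h | ⟨-, h⟩
    · exact hne (eq_of_add_eq_zero_pi h)
    · have := congrFun h ⟨v, hvy⟩
      rw [Pi.add_apply, heq, CharTwo.add_self_eq_zero, oddRowsYellow, oddRows, hv1, hv2,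
        if_pos (by omega)] at this
      exact zero_ne_one this
  -- Both δ and Mδ ≤ (9/10)^m · 9/20 decrease in m, so the Paley–Zygmund condition need only be
  -- checked at m = 3. At m = 1 these bounds would not suffice.
  · have hδ : (9 / 20 : ℝ) ^ (m + 1) ≤ (9 / 20) ^ 4 :=
      pow_le_pow_of_le_one (by norm_num) (by norm_num) (by omega)
    have hM : ((pathSet x).card : ℝ) * (9 / 20) ^ (m + 1) ≤ (9 / 10) ^ 3 * (9 / 20) := by
      calc _ ≤ (2 : ℝ) ^ m * (9 / 20) ^ (m + 1) := by
            gcongr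
            exact_mod_cast card_pathSet_le x
        _ = (9 / 10) ^ m * (9 / 20) := by
            rw [pow_succ, ← mul_assoc, ← mul_pow]; norm_num
        _ ≤ _ := by
            gcongr ?_ * _
            exact pow_le_pow_of_le_one (by norm_num) (by norm_num) h3
    refine pathSum_anticoncentration _ _ _ (pathSet x) (pathSet_nonempty x) (oddRowsYellow m)
      ((9 / 20) ^ (m + 1)) (by positivity) (hδ.trans (by norm_num)) ?_ hsep ?_
    · calc _ ≤ (2 + (9 / 10 : ℝ) ^ 3 * (9 / 20)) / 12 := by gcongr
        _ ≤ (1 / 2 - (9 / 20) ^ 4) ^ 2 := by norm_num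
        _ ≤ _ := by gcongr
    · intro z₁ h₁ z₂ h₂ z₃ h₃ z₄ h₄ h
      refine (pathSet_sum_four h₁ h₂ h₃ h₄ h).imp_right fun h' => ⟨h'.2, ?_⟩
      calc _ ≤ √(9 / 20 : ℝ) ^ (2 * (m + 1)) := by
            refine pow_le_pow_of_le_one (Real.sqrt_nonneg _) ?_ (le_card_oddRowsYellow h3)
            exact Real.sqrt_le_one.2 (by norm_num)
        _ = _ := by rw [pow_mul, Real.sq_sqrt (by norm_num)]

/-- By `card_pathSet` the prefactor of |S|² in the outcome probability is 1/(N · M), with M the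
number of paths, so the threshold 1/(2N) becomes M/2. -/
lemma le_qCond_iff {m : ℕ} (x : Site m → ZMod 2) (β : Config m) :
    1 / (2 * (dimN m : ℝ)) ≤ qCond x β ↔
      ((pathSet x).card : ℝ) / 2 ≤ ‖pathSum x (pinkBits β, β.2)‖ ^ 2 := by
  have hq : qCond x β = ‖amplitude x β‖ ^ 2 := qCond_eq x β
  have hN : (dimN m : ℝ) = 2 ^ Fintype.card (Site m) := by simp [dimN]
  have hC : ((2 : ℝ)) ^ Fintype.card (Yellow m) = 2 ^ Fintype.card (Blue m) * (pathSet x).card := by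
    exact_mod_cast card_pathSet x
  have hpos : (0 : ℝ) < (pathSet x).card := by exact_mod_cast (pathSet_nonempty x).card_pos
  rw [hq, norm_amplitude_sq, hN, hC]
  have h : (2 : ℝ) ^ Fintype.card (Blue m) / (2 ^ Fintype.card (Site m) *
      (2 ^ Fintype.card (Blue m) * (pathSet x).card)) * ‖pathSum x (pinkBits β, β.2)‖ ^ 2 =
      (1 / 2 ^ Fintype.card (Site m)) *
        (‖pathSum x (pinkBits β, β.2)‖ ^ 2 / (pathSet x).card) := by
    field_simp
  rw [h, show (1 : ℝ) / (2 * 2 ^ Fintype.card (Site m)) =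
    (1 / 2 ^ Fintype.card (Site m)) * (1 / 2) by field_simp,
    mul_le_mul_iff_of_pos_left (by positivity), le_div_iff₀ hpos]
  constructor <;> intro h <;> linarith

/-- Configurations as pairs of pink bits and yellow phases. -/
def configEquiv (m : ℕ) : Config m ≃ (Pink m → ZMod 2) × (Yellow m → Fin 4) where
  toFun β := (pinkBits β, β.2)
  invFun p := (p.1, p.2)
  left_inv _ := rfl
  right_inv _ := rfl

theorem prConfig_ge {m : ℕ} (x : Site m → ZMod 2) :
    (1 / 12 : ℝ) ≤ prConfig fun β : Config m => 1 / (2 * (dimN m : ℝ)) ≤ qCond x β := by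
  classical
  have hn : (0 : ℝ) < (Sac m).ncard := by exact_mod_cast ncard_Sac_pos m
  have hle : ((Sac m).ncard : ℝ) ≤
      Fintype.card ((Pink m → ZMod 2) × (Yellow m → Fin 4)) := by
    rw [← Fintype.card_congr (configEquiv m)]
    exact_mod_cast ncard_Sac_le m
  have hsum : (prConfig fun β : Config m => 1 / (2 * (dimN m : ℝ)) ≤ qCond x β) =
      ((Finset.univ.filter fun β => ((pathSet x).card : ℝ) / 2 ≤ ‖pathSum x β‖ ^ 2).card : ℝ) /
        (Sac m).ncard := by
    have : ∀ β : Config m, (if 1 / (2 * (dimN m : ℝ)) ≤ qCond x β then qMarginal β else 0) =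
        if ((pathSet x).card : ℝ) / 2 ≤ ‖pathSum x (configEquiv m β)‖ ^ 2
          then 1 / ((Sac m).ncard : ℝ) else 0 := by
      intro β
      rw [qMarginal_eq]
      exact if_congr (le_qCond_iff x β) rfl rfl
    rw [prConfig, Finset.sum_congr rfl fun β _ => this β,
      Equiv.sum_comp (configEquiv m) fun p => if ((pathSet x).card : ℝ) / 2 ≤ ‖pathSum x p‖ ^ 2
          then 1 / ((Sac m).ncard : ℝ) else 0, ← Finset.sum_filter, Finset.sum_const, nsmul_eq_mul,
      mul_one_div]
  rw [hsum, le_div_iff₀ hn]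
  refine le_trans ?_ (pathSum_large x)
  linarith

end QuenchArch

theorem mainTheorem3 (m : ℕ) :
    (∀ β : QuenchArch.Config m,
      QuenchArch.qMarginal β = 1 / ((QuenchArch.Sac m).ncard : ℝ)) ∧
    ∀ x : QuenchArch.Bits (QuenchArch.Site m),
      (1 / 12 : ℝ) ≤ QuenchArch.prConfig fun β : QuenchArch.Config m =>
        1 / (2 * (QuenchArch.dimN m : ℝ)) ≤ QuenchArch.qCond x β :=
  ⟨QuenchArch.qMarginal_eq, fun x => QuenchArch.prConfig_ge (m := m) x⟩
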